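/- Let $\mathbb{H}=\{(r,\theta): r>0,\ \theta\in\mathbb{R}\}$. A function $f$ is polar-analytic on an open set $U\subset\mathbb{H}$ if at each $(r_0,\theta_0)\in U$ the polar derivative $$(D_{\rm pol}f)(r_0,\theta_0):=\lim_{(r,\theta)\to(r_0,\theta_0)}\frac{f(r,\theta)-f(r_0,\theta_0)}{re^{i\theta}-r_0e^{i\theta_0}}$$ exists. For $c\in\mathbb{R}$ put $(re^{i\theta})^c:=r^ce^{ic\theta}$ for $(r,\theta)\in\mathbb{H}$, and for $k\in\mathbb{N}_0$ $$\widetilde\Theta_c^kf(r,\theta):=\sum_{j=0}^kS_c(k,j)\,r^je^{ij\theta}\,D_{\rm pol}^jf(r,\theta),$$ where the generalized Stirling numbers $S_c(k,j)$ are given by $S_c(0,0)=1$, $S_c(0,j)=0$ for $j\ge1$, $S_c(k+1,0)=c\,S_c(k,0)$ and $S_c(k+1,j+1)=S_c(k,j)+(c+j+1)S_c(k,j+1)$. A point $(r_0,\theta_0)\in\mathbb{H}$ is a logarithmic pole of order $k\ge1$ of $f$ if it has an open neighbourhood $U\subset\mathbb{H}$ such that $f$ is polar-analytic on $U\setminus\{(r_0,\theta_0)\}$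 and there is a polar-analytic function $g$ on $U$ with $g(r_0,\theta_0)\neq0$ and $$f(r,\theta)=\frac{g(r,\theta)}{\bigl(\log(r/r_0)+i(\theta-\theta_0)\bigr)^k}\qquad\text{for }(r,\theta)\in U\setminus\{(r_0,\theta_0)\}.$$ In this case the $c$-residue of $f$ at $(r_0,\theta_0)$ is $$({\rm res}_cf)(r_0,\theta_0):=(r_0e^{i\theta_0})^c\,\frac{(\widetilde\Theta_c^{k-1}g)(r_0,\theta_0)}{(k-1)!}.$$ **Theorem.** Let $\mathcal{D}\subset\mathbb{H}$ be a convex domain and let $f$ be polar-analytic on $\mathcal{D}$ except for isolated singularities which are all logarithmic poles. Let $\gamma$ be a positively oriented, simple closed, piecewise continuously differentiable curve in $\mathcal{D}$ that is the boundary of a convex domain ${\rm int}(\gamma)\subset\mathcal{D}$, and suppose that no isolated singularity lies on $\gamma$. Then only finitely many isolated singularities $(r_1,\theta_1),\dots,(r_m,\theta_m)$ lie in ${\rm int}(\gamma)$, the integral below exists, and for every $c\in\mathbb{R}$ $$\int_\gamma(re^{i\theta})^{c-1}f(r,\theta)\,e^{i\theta}\,(dr+ir\,d\theta)=2\pi i\sum_{j=1}^m({\rm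 res}_cf)(r_j,\theta_j).$$ -/

import Mathlib

open Filter Topology

noncomputable section

namespace Polar

/-- The half-plane of all `(r, θ)` with `r > 0` and `θ` real. -/
def halfPlane : Set (ℝ × ℝ) := {p | 0 < p.1}

/-- The complex number `r e^{iθ}`. -/
def toComplex (p : ℝ × ℝ) : ℂ := (p.1 : ℂ) * Complex.exp (Complex.I * p.2)

/-- `(r e^{iθ})^c = r^c e^{icθ}`, a single-valued function of `(r, θ)`
(no reduction of `θ` modulo `2π`). -/
def cpow (c : ℝ) (p : ℝ × ℝ) : ℂ := ((p.1 ^ c : ℝ) : ℂ) * Complex.exp (Complex.I * (c * p.2))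

/-- `f` has polar derivative `d` at `p`. -/
def HasPolarDerivAt (f : ℝ × ℝ → ℂ) (d : ℂ) (p : ℝ × ℝ) : Prop :=
  Tendsto (fun q => (f q - f p) / (toComplex q - toComplex p)) (𝓝[≠] p) (𝓝 d)

/-- `f` is polar-analytic on `U`: the polar derivative exists at each point of `U`. -/
def PolarAnalyticOn (f : ℝ × ℝ → ℂ) (U : Set (ℝ × ℝ)) : Prop :=
  ∀ p ∈ U, ∃ d : ℂ, HasPolarDerivAt f d p

/-- The polar derivative `D_pol f` (meaningful wherever it exists). -/
def polarDeriv (f : ℝ × ℝ → ℂ) (p : ℝ × ℝ) : ℂ :=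
  limUnder (𝓝[≠] p) fun q => (f q - f p) / (toComplex q - toComplex p)

/-- The generalized Stirling numbers of the second kind `S_c(k, j)`, i.e. the coefficients in
`(x d/dx + c)^k = ∑ j ≤ k, S_c(k, j) x^j (d/dx)^j`. -/
def stirling (c : ℝ) : ℕ → ℕ → ℝ
  | 0, 0 => 1
  | 0, _ + 1 => 0
  | k + 1, 0 => c * stirling c k 0
  | k + 1, j + 1 => stirling c k j + (c + (j + 1)) * stirling c k (j + 1)

/-- The polar Mellin derivative of order `k`:
`Θ̃_c^k f (r, θ) = ∑ j ≤ k, S_c(k, j) r^j e^{ijθ} D_pol^j f (r, θ)`. -/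
def mellinDeriv (c : ℝ) (k : ℕ) (f : ℝ × ℝ → ℂ) (p : ℝ × ℝ) : ℂ :=
  ∑ j ∈ Finset.range (k + 1), (stirling c k j : ℂ) * toComplex p ^ j * (polarDeriv^[j] f) p

/-- Near `p`, off `p` itself, `f` equals `g / (log (r/r₀) + i(θ - θ₀))^k`, where `p = (r₀, θ₀)`,
`k ≥ 1`, and `g` is polar-analytic near `p` with `g p ≠ 0`. -/
def IsLogPoleWith (f : ℝ × ℝ → ℂ) (p : ℝ × ℝ) (k : ℕ) (g : ℝ × ℝ → ℂ) : Prop :=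
  1 ≤ k ∧ g p ≠ 0 ∧
    ∃ U : Set (ℝ × ℝ), IsOpen U ∧ U ⊆ halfPlane ∧ p ∈ U ∧
      PolarAnalyticOn f (U \ {p}) ∧ PolarAnalyticOn g U ∧
      ∀ q ∈ U \ {p},
        f q = g q / ((Real.log (q.1 / p.1) : ℂ) + Complex.I * ((q.2 - p.2 : ℝ) : ℂ)) ^ k

/-- `p` is a logarithmic pole of `f` (of some order). -/
def IsLogPole (f : ℝ × ℝ → ℂ) (p : ℝ × ℝ) : Prop :=
  ∃ (k : ℕ) (g : ℝ × ℝ → ℂ), IsLogPoleWith f p k g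

open Classical in
/-- The `c`-residue of `f` at the logarithmic pole `p`, namely
`(r₀ e^{iθ₀})^c (Θ̃_c^{k-1} g)(p) / (k-1)!`. It does not depend on the choice of the
factorization (see `residue_eq`). It is set to `0` if `p` is not a logarithmic pole. -/
def residue (c : ℝ) (f : ℝ × ℝ → ℂ) (p : ℝ × ℝ) : ℂ :=
  if h : IsLogPole f p then
    cpow c p * mellinDeriv c (h.choose - 1) h.choose_spec.choose p / ((h.choose - 1).factorial : ℂ)
  else 0

/-- The complex-valued one-form `(r e^{iθ})^{c-1} f(r, θ) e^{iθ} (dr + i r dθ)`. -/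
def form (c : ℝ) (f : ℝ × ℝ → ℂ) (p : ℝ × ℝ) : ℝ × ℝ →L[ℝ] ℂ :=
  (cpow (c - 1) p * f p * Complex.exp (Complex.I * p.2)) •
    (Complex.ofRealCLM.comp (ContinuousLinearMap.fst ℝ ℝ ℝ) +
      (Complex.I * p.1) • Complex.ofRealCLM.comp (ContinuousLinearMap.snd ℝ ℝ ℝ))

/-- `γ` is piecewise continuously differentiable: apart from finitely many break points, which
cut `[0, 1]` into closed pieces, it is continuously differentiable on each closed piece. -/
def IsPiecewiseC1 {p₀ : ℝ × ℝ} (γ : Path p₀ p₀) : Prop :=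
  ∃ S : Finset ℝ, ∀ u v : ℝ, 0 ≤ u → u < v → v ≤ 1 → (∀ s ∈ S, s ∉ Set.Ioo u v) →
    ContDiffOn ℝ 1 γ.extend (Set.Icc u v)

/-- The closed path `γ` is a piecewise continuously differentiable simple closed curve whose
trace is the boundary of the convex domain `K`, and it is positively oriented:
`K` lies to the left of the direction of motion, i.e. `det (γ'(t), q - γ(t)) ≥ 0` for `q ∈ K`
(at the finitely many break points, where `γ` may fail to be differentiable, nothing is said). -/
structure IsPosBoundary {p₀ : ℝ × ℝ} (γ : Path p₀ p₀) (K : Set (ℝ × ℝ)) : Prop where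
  isOpen : IsOpen K
  nonempty : K.Nonempty
  convex : Convex ℝ K
  range_eq : Set.range γ = frontier K
  simple : Set.InjOn γ.extend (Set.Ico 0 1)
  piecewiseC1 : IsPiecewiseC1 γ
  pos : ∀ t ∈ Set.Ioo (0 : ℝ) 1, DifferentiableAt ℝ γ.extend t → ∀ q ∈ K,
    0 ≤ (deriv γ.extend t).1 * (q.2 - (γ.extend t).2) -
      (deriv γ.extend t).2 * (q.1 - (γ.extend t).1)

theorem toComplex_sub_ne (p : ℝ × ℝ) (hp : p ∈ halfPlane) :
    ∀ᶠ q in 𝓝[≠] p, toComplex q - toComplex p ≠ 0 := by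
  have hp' : 0 < p.1 := hp
  have h1 : ∀ᶠ q : ℝ × ℝ in 𝓝 p, 0 < q.1 := continuous_fst.continuousAt.eventually_const_lt hp'
  have h2 : ∀ᶠ q : ℝ × ℝ in 𝓝 p, p.2 - 1 < q.2 :=
    continuous_snd.continuousAt.eventually_const_lt (by linarith)
  have h3 : ∀ᶠ q : ℝ × ℝ in 𝓝 p, q.2 < p.2 + 1 :=
    continuous_snd.continuousAt.eventually_lt_const (by linarith)
  filter_upwards [nhdsWithin_le_nhds h1, nhdsWithin_le_nhds h2, nhdsWithin_le_nhds h3,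
    self_mem_nhdsWithin] with q q1 q2 q3 hne h
  apply hne
  have h := sub_eq_zero.mp h
  have hn := congrArg norm h
  have e : ∀ x : ℝ, ‖Complex.exp (Complex.I * x)‖ = 1 := fun x => by
    rw [mul_comm]; exact Complex.norm_exp_ofReal_mul_I x
  simp only [toComplex, norm_mul, e, Complex.norm_real, mul_one, Real.norm_eq_abs,
    abs_of_pos q1, abs_of_pos hp'] at hn
  have hpc : (p.1 : ℂ) ≠ 0 := by exact_mod_cast hp'.ne'
  simp only [toComplex, hn] at h
  have h := mul_left_cancel₀ hpc h
  obtain ⟨n, hn2⟩ := Complex.exp_eq_exp_iff_exists_int.mp h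
  have him := congrArg Complex.im hn2
  simp at him
  have hpi := Real.pi_gt_three
  have n0 : n = 0 := by
    have a : (n : ℝ) < 1 := by
      by_contra hc; push Not at hc; nlinarith
    have b : (-1 : ℝ) < n := by
      by_contra hc; push Not at hc; nlinarith
    have a' : n < 1 := by exact_mod_cast a
    have b' : -1 < n := by exact_mod_cast b
    omega
  subst n0
  simp at him
  exact Prod.ext hn him

theorem HasPolarDerivAt.continuousAt {f : ℝ × ℝ → ℂ} {d : ℂ} {p : ℝ × ℝ} (hp : p ∈ halfPlane)
    (h : HasPolarDerivAt f d p) : ContinuousAt f p := by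
  rw [continuousAt_iff_punctured_nhds]
  have hc : Continuous toComplex := by unfold toComplex; fun_prop
  have h0 : Tendsto (fun q => toComplex q - toComplex p) (𝓝[≠] p) (𝓝 0) := by
    have := (hc.tendsto p).sub_const (toComplex p)
    rw [sub_self] at this
    exact this.mono_left nhdsWithin_le_nhds
  have h2 := (Tendsto.mul h h0).add_const (f p)
  simp only [mul_zero, zero_add] at h2
  refine h2.congr' ?_
  filter_upwards [toComplex_sub_ne p hp] with q hq
  rw [div_mul_cancel₀ _ hq, sub_add_cancel]

theorem polarDeriv_congr {f g : ℝ × ℝ → ℂ} {p : ℝ × ℝ} (h : f =ᶠ[𝓝 p] g) :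
    polarDeriv f =ᶠ[𝓝 p] polarDeriv g := by
  filter_upwards [eventually_eventually_nhds.mpr h] with q hq
  unfold polarDeriv limUnder
  congr 1
  apply Filter.map_congr
  filter_upwards [nhdsWithin_le_nhds hq] with x hx
  rw [hx, hq.self_of_nhds]

theorem iterate_polarDeriv_congr {f g : ℝ × ℝ → ℂ} {p : ℝ × ℝ} (h : f =ᶠ[𝓝 p] g) (j : ℕ) :
    polarDeriv^[j] f =ᶠ[𝓝 p] polarDeriv^[j] g := by
  induction j with
  | zero => exact h
  | succ j ih => simp only [Function.iterate_succ_apply']; exact polarDeriv_congr ih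

theorem IsLogPoleWith.eventually {f g : ℝ × ℝ → ℂ} {p : ℝ × ℝ} {k : ℕ}
    (h : IsLogPoleWith f p k g) :
    ContinuousAt g p ∧ ∀ᶠ q in 𝓝[≠] p,
      ((Real.log (q.1 / p.1) : ℂ) + Complex.I * ((q.2 - p.2 : ℝ) : ℂ)) ≠ 0 ∧
      g q = f q * ((Real.log (q.1 / p.1) : ℂ) + Complex.I * ((q.2 - p.2 : ℝ) : ℂ)) ^ k := by
  obtain ⟨-, -, U, hU, hUH, hpU, -, hg, hfg⟩ := h
  obtain ⟨d, hd⟩ := hg p hpU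
  refine ⟨hd.continuousAt (hUH hpU), ?_⟩
  filter_upwards [nhdsWithin_le_nhds (hU.mem_nhds hpU), self_mem_nhdsWithin] with q hq hne
  have hp0 : 0 < p.1 := hUH hpU
  have hq0 : 0 < q.1 := hUH hq
  have hL : ((Real.log (q.1 / p.1) : ℂ) + Complex.I * ((q.2 - p.2 : ℝ) : ℂ)) ≠ 0 := by
    intro h0
    have hre := congrArg Complex.re h0
    have him := congrArg Complex.im h0
    simp only [Complex.add_re, Complex.ofReal_re, Complex.mul_re, Complex.I_re, zero_mul,
      Complex.I_im, Complex.ofReal_im, mul_zero, sub_zero, add_zero, Complex.zero_re] at hre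
    simp only [Complex.add_im, Complex.ofReal_im, Complex.mul_im, Complex.I_re, zero_mul,
      Complex.I_im, Complex.ofReal_re, one_mul, zero_add, Complex.zero_im] at him
    have h1 := Real.eq_one_of_pos_of_log_eq_zero (div_pos hq0 hp0) hre
    have h2 : q.1 = p.1 := by field_simp at h1; exact h1
    exact hne (Prod.ext h2 (sub_eq_zero.mp him))
  refine ⟨hL, ?_⟩
  rw [hfg q ⟨hq, hne⟩, div_mul_cancel₀ _ (pow_ne_zero _ hL)]

theorem IsLogPoleWith.le {f g g' : ℝ × ℝ → ℂ} {p : ℝ × ℝ} {k k' : ℕ} (hp : p ∈ halfPlane)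
    (h : IsLogPoleWith f p k g) (h' : IsLogPoleWith f p k' g') : k' ≤ k := by
  by_contra hlt
  push Not at hlt
  obtain ⟨m, rfl⟩ := Nat.exists_eq_add_of_lt hlt
  have hL : ContinuousAt (fun q : ℝ × ℝ =>
      ((Real.log (q.1 / p.1) : ℂ) + Complex.I * ((q.2 - p.2 : ℝ) : ℂ))) p := by
    have hp0 : p.1 ≠ 0 := ne_of_gt hp
    have : p.1 / p.1 ≠ 0 := by simp [hp0]
    fun_prop (disch := assumption)
  have t1 := (h.eventually.1.mul (hL.pow (m + 1))).tendsto.mono_left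
    (nhdsWithin_le_nhds (s := {p}ᶜ))
  have t2 := h'.eventually.1.tendsto.mono_left (nhdsWithin_le_nhds (s := {p}ᶜ))
  have t3 := t1.congr' (f₂ := g') (by
    filter_upwards [h.eventually.2, h'.eventually.2] with q a b
    simp only [Pi.mul_apply, Pi.pow_apply]
    rw [a.2, b.2]; ring)
  have e := tendsto_nhds_unique t2 t3
  apply h'.2.1
  rw [e]
  have hp0 : p.1 ≠ 0 := ne_of_gt hp
  simp [div_self hp0]

/-- The residue is well defined: every admissible factorization computes it. -/
theorem residue_eq {f g : ℝ × ℝ → ℂ} {p : ℝ × ℝ} {k : ℕ} (c : ℝ) (h : IsLogPoleWith f p k g) :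
    residue c f p = cpow c p * mellinDeriv c (k - 1) g p / ((k - 1).factorial : ℂ) := by
  have hp : p ∈ halfPlane := by
    obtain ⟨-, -, U, -, hUH, hpU, -⟩ := h
    exact hUH hpU
  have hex : IsLogPole f p := ⟨k, g, h⟩
  have h' := hex.choose_spec.choose_spec
  have hk : hex.choose = k := le_antisymm (h.le hp h') (h'.le hp h)
  rw [residue, dif_pos hex]
  generalize hex.choose_spec.choose = g' at h' ⊢
  rw [hk] at h' ⊢
  have hne : g' =ᶠ[𝓝[≠] p] g := by
    filter_upwards [h.eventually.2, h'.eventually.2] with q a b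
    rw [a.2, b.2]
  have hpe : g' p = g p :=
    tendsto_nhds_unique (h'.eventually.1.tendsto.mono_left (nhdsWithin_le_nhds (s := {p}ᶜ)))
      ((h.eventually.1.tendsto.mono_left (nhdsWithin_le_nhds (s := {p}ᶜ))).congr' hne.symm)
  have he : g' =ᶠ[𝓝 p] g := by
    filter_upwards [eventually_nhdsWithin_iff.mp hne] with q hq
    by_cases hqp : q = p
    · rw [hqp, hpe]
    · exact hq hqp
  have hm : mellinDeriv c (k - 1) g' p = mellinDeriv c (k - 1) g p := by
    unfold mellinDeriv
    refine Finset.sum_congr rfl fun j _ => ?_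
    rw [(iterate_polarDeriv_congr he j).self_of_nhds]
  rw [hm]

end Polar

end

open MeasureTheory Set

namespace Polar

/-! In the coordinate `w = log r + iθ` the half-plane becomes all of `ℂ` and `r e^{iθ}` becomes `exp
w`. Polar analyticity is then holomorphy of `f ∘ expCoord` (`hasPolarDerivAt_iff`), the one-form is
`e^{cw} f dw` (`form_eq_logForm`), and a logarithmic pole is an ordinary pole. The Stirling numbers
are what one gets by expanding the derivatives of `e^{cw} g` (`iteratedDeriv_exp_mul`), so the
`c`-residue is the ordinary residue of `e^{cw} f`, and the claim is a residue theorem in `w`.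

The change of coordinate does not preserve convexity, so the geometry is done in the `(r, θ)`-plane.
The poles are isolated, hence some convex neighbourhood of `closure K` has no poles outside `K`.
After subtraction of the principal parts, the remaining form is closed there, hence exact
(`exists_hasFDerivAt_logForm`), and integrates to zero. The powers `(w - w_p)^{-n}` with `n ≥ 2`
have primitives.

There remains `dw / (w - w_p)`. It differs from `dζ / (ζ - ζ_p)`, `ζ = r + iθ`, by an exact form
(`hasFDerivAt_log_div_toPlane`), and the latter integrates to `2πi`
(`IsPosBoundary.integral_planeWindingForm`): by convexity and orientation the argument of `γ - p` is
monotone, and by simplicity it increases by exactly one turn. -/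

theorem integrableOn_deriv_of_contDiffOn {E : Type*} [NormedAddCommGroup E] [NormedSpace ℝ E]
    {g : ℝ → E} {u v : ℝ} (hg : u < v → ContDiffOn ℝ 1 g (Icc u v)) :
    IntegrableOn (deriv g) (Icc u v) := by
  rcases lt_or_ge u v with huv | huv
  · have h := ((hg huv).continuousOn_derivWithin (uniqueDiffOn_Icc huv) le_rfl).integrableOn_Icc
      (μ := volume)
    rw [integrableOn_Icc_iff_integrableOn_Ioo] at h ⊢
    refine h.congr_fun (fun t ht => ?_) measurableSet_Ioo
    exact derivWithin_of_mem_nhds (Icc_mem_nhds ht.1 ht.2)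
  · rw [integrableOn_Icc_iff_integrableOn_Ioo, Ioo_eq_empty (not_lt.mpr huv)]
    exact integrableOn_empty

/-! ### Integration along piecewise continuously differentiable closed curves. -/

section Curve

variable {p₀ : ℝ × ℝ} {γ : Path p₀ p₀}

theorem extend_mem_range (γ : Path p₀ p₀) (t : ℝ) : γ.extend t ∈ range γ := by
  rw [← γ.extend_range]; exact mem_range_self t

theorem IsPiecewiseC1.exists_contDiffAt (hγ : IsPiecewiseC1 γ) :
    ∃ S : Finset ℝ, ∀ t ∈ Ioo (0 : ℝ) 1 \ (S : Set ℝ), ContDiffAt ℝ 1 γ.extend t := by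
  obtain ⟨S, hS⟩ := hγ
  refine ⟨S, fun t ht => ?_⟩
  have hn : Ioo (0 : ℝ) 1 \ (S : Set ℝ) ∈ 𝓝 t :=
    (isOpen_Ioo.sdiff S.finite_toSet.isClosed).mem_nhds ht
  obtain ⟨u, v, htuv, hsub⟩ := mem_nhds_iff_exists_Ioo_subset.mp hn
  have huv : u < v := htuv.1.trans htuv.2
  have h01 := (Ioo_subset_Ioo_iff huv).mp (hsub.trans sdiff_subset)
  exact (hS u v h01.1 huv h01.2 fun s hs hsuv => (hsub hsuv).2 hs).contDiffAt
    (Icc_mem_nhds htuv.1 htuv.2)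

/-- Local integrability and compactness of `[0, 1]` make it unnecessary to sort the break points: a
small interval around `t` contains no break point except possibly `t`, so the two halves at `t`
suffice. -/
theorem IsPiecewiseC1.intervalIntegrable_deriv (hγ : IsPiecewiseC1 γ) :
    IntervalIntegrable (deriv γ.extend) volume 0 1 := by
  obtain ⟨S, hS⟩ := hγ
  rw [intervalIntegrable_iff_integrableOn_Icc_of_le zero_le_one]
  refine LocallyIntegrableOn.integrableOn_isCompact (fun t ht => ?_) isCompact_Icc
  have hn : ((S : Set ℝ) \ {t})ᶜ ∈ 𝓝 t :=
    (S.finite_toSet.sdiff (t := {t})).isClosed.isOpen_compl.mem_nhds (by simp)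
  obtain ⟨u, v, htuv, hsub⟩ := mem_nhds_iff_exists_Ioo_subset.mp hn
  have hne : ∀ s ∈ S, s ≠ t → s ∉ Ioo u v := fun s hs hst hsuv => hsub hsuv ⟨hs, hst⟩
  have hl : IntegrableOn (deriv γ.extend) (Icc (max u 0) t) := by
    refine integrableOn_deriv_of_contDiffOn fun hut => hS _ _ (le_max_right _ _) hut ht.2 ?_
    intro s hs hst
    exact hne s hs hst.2.ne ⟨(le_max_left _ _).trans_lt hst.1, hst.2.trans htuv.2⟩
  have hr : IntegrableOn (deriv γ.extend) (Icc t (min v 1)) := by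
    refine integrableOn_deriv_of_contDiffOn fun hut => hS _ _ ht.1 hut (min_le_right _ _) ?_
    intro s hs hst
    exact hne s hs hst.1.ne' ⟨htuv.1.trans hst.1, hst.2.trans_le (min_le_left _ _)⟩
  refine ⟨_, ?_, hl.union hr⟩
  rw [mem_nhdsWithin]
  refine ⟨Ioo u v, isOpen_Ioo, htuv, fun s hs => ?_⟩
  rcases le_total s t with h | h
  · exact Or.inl ⟨max_le hs.1.1.le hs.2.1, h⟩
  · exact Or.inr ⟨h, le_min hs.1.2.le hs.2.2⟩

theorem IsPiecewiseC1.intervalIntegrable_form (hγ : IsPiecewiseC1 γ)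
    {ω : ℝ × ℝ → ℝ × ℝ →L[ℝ] ℂ} (hω : ContinuousOn ω (range γ)) :
    IntervalIntegrable (fun t => ω (γ.extend t) (deriv γ.extend t)) volume 0 1 := by
  have hd := hγ.intervalIntegrable_deriv
  have h1 : IntervalIntegrable (fun t => (((deriv γ.extend t).1 : ℝ) : ℂ)) volume 0 1 :=
    ⟨hd.1.fst.ofReal, hd.2.fst.ofReal⟩
  have h2 : IntervalIntegrable (fun t => (((deriv γ.extend t).2 : ℝ) : ℂ)) volume 0 1 :=
    ⟨hd.1.snd.ofReal, hd.2.snd.ofReal⟩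
  have hc : Continuous fun t => ω (γ.extend t) :=
    hω.comp_continuous γ.continuous_extend (extend_mem_range γ)
  have c1 : Continuous fun t => ω (γ.extend t) (1, 0) := hc.clm_apply continuous_const
  have c2 : Continuous fun t => ω (γ.extend t) (0, 1) := hc.clm_apply continuous_const
  refine ((h1.continuousOn_mul c1.continuousOn).add (h2.continuousOn_mul c2.continuousOn)).congr ?_
  intro t _
  have hv : deriv γ.extend t = (deriv γ.extend t).1 • ((1 : ℝ), (0 : ℝ)) +
      (deriv γ.extend t).2 • ((0 : ℝ), (1 : ℝ)) := by ext <;> simp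
  beta_reduce
  conv_rhs => rw [hv]
  simp only [map_add, map_smul, Complex.real_smul]
  ring

theorem curveIntegrable_of_intervalIntegrable {ω : ℝ × ℝ → ℝ × ℝ →L[ℝ] ℂ}
    (h : IntervalIntegrable (fun t => ω (γ.extend t) (deriv γ.extend t)) volume 0 1) :
    CurveIntegrable ω γ := by
  rw [CurveIntegrable]
  rw [intervalIntegrable_iff_integrableOn_Ioo_of_le zero_le_one] at h ⊢
  refine h.congr_fun (fun t ht => ?_) measurableSet_Ioo
  simp only [curveIntegralFun_def]
  rw [derivWithin_of_mem_nhds (Icc_mem_nhds ht.1 ht.2)]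

/-- Fundamental theorem of calculus off the finite set of break points; `Q ∘ γ` takes the same value
at both ends. -/
theorem IsPiecewiseC1.integral_eq_zero_of_hasFDerivAt (hγ : IsPiecewiseC1 γ)
    {ω : ℝ × ℝ → ℝ × ℝ →L[ℝ] ℂ} {Q : ℝ × ℝ → ℂ} (hω : ContinuousOn ω (range γ))
    (hQ : ∀ p ∈ range γ, HasFDerivAt Q (ω p) p) :
    ∫ t in (0 : ℝ)..1, ω (γ.extend t) (deriv γ.extend t) = 0 := by
  obtain ⟨S, hS⟩ := hγ.exists_contDiffAt
  have hQc : ContinuousOn Q (range γ) := fun p hp => (hQ p hp).continuousAt.continuousWithinAt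
  rw [integral_eq_of_hasDerivAt_off_countable (Q ∘ γ.extend) _ S.countable_toSet
    (hQc.comp_continuous γ.continuous_extend (extend_mem_range γ)).continuousOn ?_
    (hγ.intervalIntegrable_form hω)]
  · simp
  · intro t ht
    rw [min_eq_left zero_le_one, max_eq_right zero_le_one] at ht
    exact (hQ _ (extend_mem_range γ t)).comp_hasDerivAt t
      ((hS t ht).differentiableAt one_ne_zero).hasDerivAt

end Curve

/-! ### Frontiers of open and convex sets. -/

section ConvexGeometry

variable {E : Type*} [NormedAddCommGroup E] [NormedSpace ℝ E] {K : Set E}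

theorem exists_mem_segment_frontier (hK : IsOpen K) {x y : E} (hx : x ∈ K) (hy : y ∉ K) :
    ∃ p ∈ segment ℝ x y, p ∈ frontier K := by
  by_contra! h
  have hy' : y ∈ (closure K)ᶜ := fun hc =>
    h y (right_mem_segment ℝ x y) ⟨hc, by rwa [hK.interior_eq]⟩
  obtain ⟨p, -, hp, hp'⟩ := (convex_segment x y).isPreconnected K (closure K)ᶜ hK
    isClosed_closure.isOpen_compl
    (fun p hp => by
      by_contra hn
      rw [mem_union, not_or, mem_compl_iff, not_not] at hn
      exact h p hp ⟨hn.2, by rw [hK.interior_eq]; exact hn.1⟩)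
    ⟨x, left_mem_segment ℝ x y, hx⟩ ⟨y, right_mem_segment ℝ x y, hy'⟩
  exact hp' (subset_closure hp)

theorem exists_pos_add_smul_mem_frontier (hK : IsOpen K) (hb : Bornology.IsBounded K) {q v : E}
    (hq : q ∈ K) (hv : v ≠ 0) : ∃ s : ℝ, 0 < s ∧ q + s • v ∈ frontier K := by
  obtain ⟨R, hR⟩ := hb.exists_norm_le
  have hvn : 0 < ‖v‖ := norm_pos_iff.mpr hv
  have hR0 : 0 ≤ R := (norm_nonneg q).trans (hR q hq)
  -- `‖T • v‖ = 2R + 1`, so `‖q + T • v‖ ≥ R + 1` exceeds the bound on `K`.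
  set T : ℝ := (2 * R + 1) / ‖v‖ with hT
  have hT0 : 0 < T := by positivity
  have hy : q + T • v ∉ K := fun h => by
    have h1 := hR _ h
    have h2 := norm_sub_norm_le (T • v) (-q)
    rw [sub_neg_eq_add, norm_neg, norm_smul, Real.norm_of_nonneg hT0.le, hT,
      div_mul_cancel₀ _ hvn.ne', add_comm _ q] at h2
    have := hR q hq
    linarith
  obtain ⟨p, hp, hpf⟩ := exists_mem_segment_frontier hK hq hy
  rw [segment_eq_image'] at hp
  obtain ⟨θ, hθ, rfl⟩ := hp
  have hθ0 : θ ≠ 0 := by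
    rintro rfl
    have : q ∈ frontier K := by simpa using hpf
    exact this.2 (by rwa [hK.interior_eq])
  refine ⟨θ * T, mul_pos (hθ.1.lt_of_ne' hθ0) hT0, ?_⟩
  simpa [smul_smul] using hpf

/-- A ray from an interior point leaves a convex set once: of two distinct frontier points on it,
the nearer one would lie on an open segment from `q` to a closure point, hence in the interior. -/
theorem frontier_ray_unique (hK : IsOpen K) (hc : Convex ℝ K) {q x y : E} (hq : q ∈ K)
    (hx : x ∈ frontier K) (hy : y ∈ frontier K) {s : ℝ} (hs : 0 < s) (h : y - q = s • (x - q)) :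
    x = y := by
  have key : ∀ {a b : E} {r : ℝ}, a ∈ frontier K → b ∈ frontier K → 0 < r → r < 1 →
      a - q ≠ r • (b - q) := fun {a b r} ha hb h0 h1 hab => by
    refine ha.2 (hc.openSegment_interior_closure_subset_interior
      (by rwa [hK.interior_eq]) hb.1 ?_ : a ∈ interior K)
    refine ⟨1 - r, r, by linarith, h0, by ring, ?_⟩
    rw [← sub_add_cancel a q, hab]
    module
  rcases lt_trichotomy s 1 with h1 | h1 | h1
  · exact absurd h (key hy hx hs h1)
  · rw [h1, one_smul] at h
    exact (sub_left_injective h).symm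
  · refine absurd ?_ (key hx hy (inv_pos.mpr hs) (inv_lt_one_of_one_lt₀ h1))
    rw [h, smul_smul, inv_mul_cancel₀ hs.ne', one_smul]

end ConvexGeometry

/-- From `p ∈ K`, the horizontal segment to `r = 0` leaves `K` and so meets the frontier at the
height of `p`, which bounds `p.2`. Points above that bound are then outside `K`, and a vertical
segment bounds `p.1`. -/
theorem isBounded_of_isCompact_frontier {K : Set (ℝ × ℝ)} (hK : IsOpen K) (hH : K ⊆ halfPlane)
    (hf : IsCompact (frontier K)) : Bornology.IsBounded K := by
  obtain ⟨R, hR⟩ := hf.isBounded.exists_norm_le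
  have hR' : ∀ p ∈ frontier K, |p.1| ≤ R ∧ |p.2| ≤ R := fun p hp => by
    have := hR p hp
    rw [Prod.norm_def, max_le_iff] at this
    exact this
  have hvert : ∀ p ∈ K, |p.2| ≤ R := fun p hp => by
    by_contra! hlt
    obtain ⟨x, hx, hxf⟩ := exists_mem_segment_frontier hK hp (y := (0, p.2))
      (fun h => lt_irrefl (0 : ℝ) (hH h))
    obtain ⟨a, b, -, -, hab, rfl⟩ := hx
    have h2 := (hR' _ hxf).2
    have e : (a • p + b • ((0 : ℝ), p.2)).2 = p.2 := by
      simp only [Prod.snd_add, Prod.smul_snd, smul_eq_mul]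
      rw [← add_mul, hab, one_mul]
    rw [e] at h2
    linarith
  have hhor : ∀ p ∈ K, |p.1| ≤ R := fun p hp => by
    by_contra! hlt
    obtain ⟨x, hx, hxf⟩ := exists_mem_segment_frontier hK hp (y := (p.1, |R| + 1))
      (fun h => by
        have h1 := (le_abs_self _).trans (hvert _ h)
        have h2 := le_abs_self R
        simp only at h1
        linarith)
    obtain ⟨a, b, -, -, hab, rfl⟩ := hx
    have h2 := (hR' _ hxf).1
    have e : (a • p + b • (p.1, |R| + 1)).1 = p.1 := by
      simp only [Prod.fst_add, Prod.smul_fst, smul_eq_mul]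
      rw [← add_mul, hab, one_mul]
    rw [e] at h2
    linarith
  refine isBounded_iff_forall_norm_le.mpr ⟨R, fun p hp => ?_⟩
  rw [Prod.norm_def, max_le_iff]
  exact ⟨hhor p hp, hvert p hp⟩

/-! ### Winding number of the boundary curve in the `(r, θ)`-plane. -/

/-- The `ℝ`-linear identification `(a, b) ↦ a + b i`. -/
noncomputable def toPlane : ℝ × ℝ →L[ℝ] ℂ := (Complex.equivRealProdCLM.symm : ℝ × ℝ →L[ℝ] ℂ)

theorem toPlane_re (p : ℝ × ℝ) : (toPlane p).re = p.1 := by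
  simp [toPlane, Complex.equivRealProdCLM_symm_apply]

theorem toPlane_im (p : ℝ × ℝ) : (toPlane p).im = p.2 := by
  simp [toPlane, Complex.equivRealProdCLM_symm_apply]

theorem toPlane_injective : Function.Injective toPlane := Complex.equivRealProdCLM.symm.injective

theorem toPlane_ne_zero {p : ℝ × ℝ} (hp : p ≠ 0) : toPlane p ≠ 0 := fun h =>
  hp (toPlane_injective (h.trans (map_zero toPlane).symm))

/-- The form `dζ / (ζ - ζ_q)` in the coordinate `ζ = r + iθ`. -/
noncomputable def planeWindingForm (q p : ℝ × ℝ) : ℝ × ℝ →L[ℝ] ℂ := (toPlane (p - q))⁻¹ • toPlane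

theorem continuousOn_planeWindingForm {q : ℝ × ℝ} {s : Set (ℝ × ℝ)} (hq : q ∉ s) :
    ContinuousOn (planeWindingForm q) s := by
  unfold planeWindingForm
  refine ContinuousOn.smul (ContinuousOn.inv₀
    (toPlane.continuous.comp (continuous_id.sub continuous_const)).continuousOn fun p hp => ?_)
    continuousOn_const
  exact toPlane_ne_zero (sub_ne_zero.mpr fun h =>
    hq ((show p = q from h) ▸ hp))

section Winding

variable {p₀ : ℝ × ℝ} {γ : Path p₀ p₀} {q : ℝ × ℝ}

/-- A continuous logarithm of `γ - q` along the curve. -/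
theorem IsPiecewiseC1.exp_integral_planeWindingForm (hγ : IsPiecewiseC1 γ) (hq : q ∉ range γ)
    {t : ℝ} (ht : t ∈ Icc (0 : ℝ) 1) :
    toPlane (γ.extend t - q) = Complex.exp (∫ s in (0 : ℝ)..t,
      planeWindingForm q (γ.extend s) (deriv γ.extend s)) * toPlane (p₀ - q) := by
  obtain ⟨S, hS⟩ := hγ.exists_contDiffAt
  set ω : ℝ → ℂ := fun s => planeWindingForm q (γ.extend s) (deriv γ.extend s) with hω
  have hint : IntervalIntegrable ω volume 0 1 :=
    hγ.intervalIntegrable_form (continuousOn_planeWindingForm hq)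
  set L : ℝ → ℂ := fun t => ∫ s in (0 : ℝ)..t, ω s with hL
  have hLc : ContinuousOn L (Icc 0 1) := by
    have := intervalIntegral.continuousOn_primitive_interval' hint (left_mem_uIcc)
    rwa [uIcc_of_le zero_le_one] at this
  have hz : Continuous fun t => toPlane (γ.extend t - q) :=
    toPlane.continuous.comp (γ.continuous_extend.sub continuous_const)
  have hz0 : ∀ t, toPlane (γ.extend t - q) ≠ 0 := fun t =>
    toPlane_ne_zero (sub_ne_zero.mpr fun h => hq (h ▸ extend_mem_range γ t))
  have hmeas : StronglyMeasurable ω := by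
    have e : ω = fun s => (toPlane (γ.extend s - q))⁻¹ * toPlane (deriv γ.extend s) := rfl
    rw [e]
    exact ((hz.measurable.inv).mul
      (toPlane.continuous.measurable.comp (measurable_deriv _))).stronglyMeasurable
  have hLd : ∀ s ∈ Ioo (0 : ℝ) 1 \ (S : Set ℝ), HasDerivAt L (ω s) s := fun s hs => by
    refine intervalIntegral.integral_hasDerivAt_right
      (hint.mono_set ?_) hmeas.stronglyMeasurableAtFilter ?_
    · rw [uIcc_of_le hs.1.1.le, uIcc_of_le zero_le_one]
      exact Icc_subset_Icc_right hs.1.2.le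
    · have hd : ContinuousAt (deriv γ.extend) s := by
        have h1 : ContinuousAt (fderiv ℝ γ.extend) s :=
          ((hS s hs).fderiv_right (m := 0) (by simp)).continuousAt
        have h2 : ContinuousAt (fun s => fderiv ℝ γ.extend s 1) s :=
          h1.clm_apply continuousAt_const
        simpa only [fderiv_apply_one_eq_deriv] using h2
      exact (hz.continuousAt.inv₀ (hz0 s)).mul (toPlane.continuous.continuousAt.comp hd)
  -- `exp (-L) * (γ - q)` is continuous and has derivative zero off the break points, so it is
  -- constant.
  have key := integral_eq_of_hasDerivAt_off_countable_of_le
    (fun s => Complex.exp (-L s) * toPlane (γ.extend s - q)) (fun _ => 0) ht.1 S.countable_toSet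
    (((hLc.mono (Icc_subset_Icc_right ht.2)).neg.cexp).mul hz.continuousOn) (fun s hs => by
      have hs' : s ∈ Ioo (0 : ℝ) 1 \ (S : Set ℝ) := ⟨⟨hs.1.1, hs.1.2.trans_le ht.2⟩, hs.2⟩
      have h1 := ((hLd s hs').neg).cexp
      have h2 : HasDerivAt (fun s => toPlane (γ.extend s - q)) (toPlane (deriv γ.extend s)) s :=
        toPlane.hasFDerivAt.comp_hasDerivAt s
          ((((hS s hs').differentiableAt one_ne_zero).hasDerivAt).sub_const q)
      refine (h1.mul h2).congr_deriv ?_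
      have e : ω s = (toPlane (γ.extend s - q))⁻¹ * toPlane (deriv γ.extend s) := rfl
      rw [e, Pi.neg_apply]
      have hz1 := mul_inv_cancel₀ (hz0 s)
      linear_combination
        (-Complex.exp (-L s) * toPlane (deriv γ.extend s)) * hz1) (by simp)
  have hL0 : L 0 = 0 := by simp [hL]
  simp only [intervalIntegral.integral_zero, hL0, neg_zero, Complex.exp_zero, one_mul,
    γ.extend_zero] at key
  rw [eq_comm, sub_eq_zero] at key
  rw [← key, ← mul_assoc, ← Complex.exp_add, add_neg_cancel, Complex.exp_zero, one_mul]

/-- The integral is `2πi n` with `n` an integer, since `γ` is closed. Monotonicity of the argument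
gives `n ≥ 0`; the cases `n = 0` and `n ≥ 2` are excluded because each ray from `q` meets the
frontier exactly once and `γ` is simple. -/
theorem IsPosBoundary.integral_planeWindingForm {K : Set (ℝ × ℝ)} (h : IsPosBoundary γ K)
    (hb : Bornology.IsBounded K) (hq : q ∈ K) :
    ∫ t in (0 : ℝ)..1, planeWindingForm q (γ.extend t) (deriv γ.extend t) =
      2 * Real.pi * Complex.I := by
  have hfr : ∀ t, γ.extend t ∈ frontier K := fun t => h.range_eq ▸ extend_mem_range γ t
  have hqf : q ∉ frontier K := fun hf => hf.2 (by rwa [h.isOpen.interior_eq])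
  have hqr : q ∉ range γ := h.range_eq ▸ hqf
  have hne : ∀ t, γ.extend t - q ≠ 0 := fun t => sub_ne_zero.mpr fun e => hqf (e ▸ hfr t)
  have hp₀ : p₀ - q ≠ 0 := by simpa using hne 0
  obtain ⟨S, hS⟩ := h.piecewiseC1.exists_contDiffAt
  set ω : ℝ → ℂ := fun s => planeWindingForm q (γ.extend s) (deriv γ.extend s) with hω
  have hint : IntervalIntegrable ω volume 0 1 :=
    h.piecewiseC1.intervalIntegrable_form (continuousOn_planeWindingForm hqr)
  set L : ℝ → ℂ := fun t => ∫ s in (0 : ℝ)..t, ω s with hL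
  have hexp : ∀ t ∈ Icc (0 : ℝ) 1,
      toPlane (γ.extend t - q) = Complex.exp (L t) * toPlane (p₀ - q) := fun t ht =>
    h.piecewiseC1.exp_integral_planeWindingForm hqr ht
  have hLc : ContinuousOn (fun t => (L t).im) (Icc 0 1) := by
    have := intervalIntegral.continuousOn_primitive_interval' hint (left_mem_uIcc)
    rw [uIcc_of_le zero_le_one] at this
    exact Complex.continuous_im.comp_continuousOn this
  have hL0 : L 0 = 0 := by simp [hL]
  have hsub : ∀ {s t : ℝ}, 0 ≤ s → s ≤ t → t ≤ 1 → IntervalIntegrable ω volume s t :=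
    fun h0 hst h1 => hint.mono_set (by
      rw [uIcc_of_le hst, uIcc_of_le zero_le_one]; exact Icc_subset_Icc h0 h1)
  -- `Im (γ' / (γ - q)) = det (γ - q, γ') / |γ - q|²`, and this determinant is the one in the
  -- orientation hypothesis.
  have hpos : ∀ t ∈ Ioo (0 : ℝ) 1 \ (S : Set ℝ), 0 ≤ (ω t).im := fun t ht => by
    have hp := h.pos t ht.1 ((hS t ht).differentiableAt one_ne_zero) q hq
    have e : ω t = (toPlane (γ.extend t - q))⁻¹ * toPlane (deriv γ.extend t) := rfl
    rw [e, Complex.mul_im, Complex.inv_re, Complex.inv_im]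
    simp only [toPlane_re, toPlane_im, Prod.fst_sub, Prod.snd_sub]
    have hn : 0 ≤ Complex.normSq (toPlane (γ.extend t - q)) := Complex.normSq_nonneg _
    rw [div_mul_eq_mul_div, div_mul_eq_mul_div, ← add_div]
    refine div_nonneg ?_ hn
    linarith
  have hmono : MonotoneOn (fun t => (L t).im) (Icc 0 1) := fun s hs t ht hst => by
    have e : L t - L s = ∫ x in s..t, ω x :=
      intervalIntegral.integral_interval_sub_left (hsub le_rfl ht.1 ht.2) (hsub le_rfl hs.1 hs.2)
    have hi := hsub hs.1 hst ht.2
    have e2 : (∫ x in s..t, ω x).im = ∫ x in s..t, (ω x).im :=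
      (Complex.imCLM.intervalIntegral_comp_comm hi).symm
    have h0 : 0 ≤ ∫ x in s..t, (ω x).im := by
      rw [intervalIntegral.integral_of_le hst, integral_Ioc_eq_integral_Ioo]
      refine setIntegral_nonneg_of_ae_restrict ?_
      have hSn : ∀ᵐ x ∂(volume.restrict (Ioo s t)), x ∉ (S : Set ℝ) :=
        (S.countable_toSet.ae_notMem volume).filter_mono (ae_mono Measure.restrict_le_self)
      filter_upwards [hSn, ae_restrict_mem measurableSet_Ioo] with x hx hxm
      exact hpos x ⟨⟨hs.1.trans_lt hxm.1, hxm.2.trans_le ht.2⟩, hx⟩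
    have e3 := congrArg Complex.im e
    rw [e2, Complex.sub_im] at e3
    simp only
    linarith
  -- equal arguments modulo `2π` give the same point
  have hsame : ∀ t ∈ Icc (0 : ℝ) 1, Complex.exp ((L t).im * Complex.I) = 1 → γ.extend t = p₀ := by
    intro t ht he
    have hx := hexp t ht
    rw [← Complex.re_add_im (L t), Complex.exp_add, he, mul_one, ← Complex.ofReal_exp,
      ← Complex.real_smul, ← map_smul] at hx
    refine (frontier_ray_unique h.isOpen h.convex hq ?_ (hfr t) (Real.exp_pos _)
      (toPlane_injective hx)).symm
    simpa using hfr 0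
  have h1 : Complex.exp (L 1) = 1 := by
    have := hexp 1 (right_mem_Icc.mpr zero_le_one)
    rw [γ.extend_one] at this
    exact (mul_eq_right₀ (toPlane_ne_zero hp₀)).mp this.symm
  obtain ⟨n, hn⟩ := Complex.exp_eq_one_iff.mp h1
  have him : (L 1).im = n * (2 * Real.pi) := by rw [hn]; simp
  have hpi := Real.pi_pos
  have hn0 : 0 ≤ n := by
    have := hmono (left_mem_Icc.mpr zero_le_one) (right_mem_Icc.mpr zero_le_one) zero_le_one
    simp only [hL0, Complex.zero_im, him] at this
    by_contra! hlt
    have : (n : ℝ) < 0 := by exact_mod_cast hlt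
    nlinarith
  -- With `n = 0` the monotone argument is constant, so `γ` stays at `p₀`; but the ray from `q`
  -- opposite to `p₀` also meets the frontier.
  have hnz : n ≠ 0 := by
    rintro rfl
    have hz : ∀ t ∈ Icc (0 : ℝ) 1, (L t).im = 0 := fun t ht => by
      have a := hmono (left_mem_Icc.mpr zero_le_one) ht ht.1
      have b := hmono ht (right_mem_Icc.mpr zero_le_one) ht.2
      simp only [hL0, Complex.zero_im] at a
      simp only [him, Int.cast_zero, zero_mul] at b
      exact le_antisymm b a
    have hall : ∀ t ∈ Icc (0 : ℝ) 1, γ.extend t = p₀ := fun t ht =>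
      hsame t ht (by simp [hz t ht])
    obtain ⟨s, hs, hsf⟩ := exists_pos_add_smul_mem_frontier h.isOpen hb hq (neg_ne_zero.mpr hp₀)
    rw [← h.range_eq, ← γ.image_extend_of_subset (s := Icc 0 1) subset_rfl] at hsf
    obtain ⟨t, ht, hte⟩ := hsf
    rw [hall t ht] at hte
    have : (1 + s) • (p₀ - q) = 0 := by
      have h2 : p₀ - q = s • -(p₀ - q) := by
        conv_lhs => rw [hte]
        simp
      rw [add_smul, one_smul]
      nth_rewrite 1 [h2]
      rw [← smul_add, neg_add_cancel, smul_zero]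
    rcases smul_eq_zero.mp this with h3 | h3
    · linarith
    · exact hp₀ h3
  -- With `n ≥ 2` the argument takes the value `2π` at some `t` strictly between `0` and `1`, where
  -- `γ` is back at `p₀`, contradicting simplicity.
  have hn2 : n ≤ 1 := by
    by_contra! hlt
    have hn2 : (2 : ℝ) ≤ n := by exact_mod_cast hlt
    obtain ⟨t, ht, hte⟩ := intermediate_value_Icc zero_le_one hLc
      (show 2 * Real.pi ∈ Icc (L 0).im (L 1).im by
        rw [hL0, him]
        constructor
        · simp; positivity
        · nlinarith)
    simp only at hte
    have hp := hsame t ht (by rw [hte]; push_cast; exact Complex.exp_two_pi_mul_I)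
    have ht1 : t ≠ 1 := by
      rintro rfl
      rw [him] at hte
      nlinarith
    have ht0 : t = 0 := h.simple ⟨ht.1, ht.2.lt_of_ne ht1⟩ ⟨le_rfl, zero_lt_one⟩
      (by rw [hp, γ.extend_zero])
    rw [ht0, hL0] at hte
    simp at hte
  have hn1 : n = 1 := by omega
  rw [hn1] at hn
  simpa using hn

end Winding

/-! ### The logarithmic coordinate. -/

/-- The logarithmic coordinate `w = log r + iθ`. -/
noncomputable def logCoord (p : ℝ × ℝ) : ℂ := (Real.log p.1 : ℂ) + Complex.I * p.2

/-- The inverse `w ↦ (e^{Re w}, Im w)` of the logarithmic coordinate. -/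
noncomputable def expCoord (w : ℂ) : ℝ × ℝ := (Real.exp w.re, w.im)

/-- The differential `dr / r + i dθ` of the logarithmic coordinate. -/
noncomputable def logCoordDeriv (p : ℝ × ℝ) : ℝ × ℝ →L[ℝ] ℂ :=
  ((p.1⁻¹ : ℝ) : ℂ) • Complex.ofRealCLM.comp (ContinuousLinearMap.fst ℝ ℝ ℝ) +
    Complex.I • Complex.ofRealCLM.comp (ContinuousLinearMap.snd ℝ ℝ ℝ)

theorem logCoord_re (p : ℝ × ℝ) : (logCoord p).re = Real.log p.1 := by simp [logCoord]

theorem logCoord_im (p : ℝ × ℝ) : (logCoord p).im = p.2 := by simp [logCoord]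

theorem logCoord_expCoord (w : ℂ) : logCoord (expCoord w) = w :=
  Complex.ext (by simp [logCoord_re, expCoord]) (by simp [logCoord_im, expCoord])

theorem expCoord_logCoord {p : ℝ × ℝ} (hp : p ∈ halfPlane) : expCoord (logCoord p) = p :=
  Prod.ext (by simp only [expCoord, logCoord_re]; exact Real.exp_log hp)
    (by simp [expCoord, logCoord_im])

theorem expCoord_mem_halfPlane (w : ℂ) : expCoord w ∈ halfPlane := Real.exp_pos _

theorem expCoord_injective : Function.Injective expCoord :=
  Function.LeftInverse.injective logCoord_expCoord

theorem logCoord_injOn : InjOn logCoord halfPlane := fun p hp q hq h => by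
  rw [← expCoord_logCoord hp, h, expCoord_logCoord hq]

theorem continuous_expCoord : Continuous expCoord := by unfold expCoord; fun_prop

theorem isOpen_halfPlane : IsOpen halfPlane := isOpen_lt continuous_const continuous_fst

theorem continuousAt_logCoord {p : ℝ × ℝ} (hp : p ∈ halfPlane) : ContinuousAt logCoord p := by
  have hp0 : p.1 ≠ 0 := ne_of_gt hp
  unfold logCoord
  fun_prop (disch := assumption)

theorem hasFDerivAt_logCoord {p : ℝ × ℝ} (hp : p ∈ halfPlane) :
    HasFDerivAt logCoord (logCoordDeriv p) p := by
  have hp0 : p.1 ≠ 0 := ne_of_gt hp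
  have h1 : HasFDerivAt (fun q : ℝ × ℝ => Real.log q.1)
      (p.1⁻¹ • ContinuousLinearMap.fst ℝ ℝ ℝ) p :=
    (Real.hasDerivAt_log hp0).comp_hasFDerivAt p hasFDerivAt_fst
  have h2 := Complex.ofRealCLM.hasFDerivAt.comp p h1
  have h3 : HasFDerivAt (fun q : ℝ × ℝ => (q.2 : ℂ))
      (Complex.ofRealCLM.comp (ContinuousLinearMap.snd ℝ ℝ ℝ)) p :=
    Complex.ofRealCLM.hasFDerivAt.comp p hasFDerivAt_snd
  refine (h2.add (h3.const_mul Complex.I)).congr_fderiv ?_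
  ext <;> simp [logCoordDeriv]

theorem exp_logCoord {p : ℝ × ℝ} (hp : p ∈ halfPlane) : Complex.exp (logCoord p) = toComplex p := by
  rw [logCoord, Complex.exp_add, ← Complex.ofReal_exp, Real.exp_log hp, toComplex]

theorem toComplex_expCoord (w : ℂ) : toComplex (expCoord w) = Complex.exp w := by
  rw [← exp_logCoord (expCoord_mem_halfPlane w), logCoord_expCoord]

theorem cpow_eq_exp {p : ℝ × ℝ} (hp : p ∈ halfPlane) (c : ℝ) :
    cpow c p = Complex.exp (c * logCoord p) := by
  rw [cpow, Real.rpow_def_of_pos hp, logCoord, mul_add, Complex.exp_add]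
  push_cast
  ring_nf

/-! ### Polar analyticity as holomorphy in the logarithmic coordinate. -/

theorem tendsto_expCoord_punctured (w : ℂ) :
    Tendsto expCoord (𝓝[≠] w) (𝓝[≠] (expCoord w)) :=
  continuous_expCoord.continuousAt.continuousWithinAt.tendsto_nhdsWithin
    fun _ hv h => hv (expCoord_injective h)

theorem tendsto_logCoord_punctured {p : ℝ × ℝ} (hp : p ∈ halfPlane) :
    Tendsto logCoord (𝓝[≠] p) (𝓝[≠] (logCoord p)) := by
  refine tendsto_nhdsWithin_iff.mpr
    ⟨(continuousAt_logCoord hp).tendsto.mono_left nhdsWithin_le_nhds, ?_⟩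
  filter_upwards [nhdsWithin_le_nhds (isOpen_halfPlane.mem_nhds hp), self_mem_nhdsWithin]
    with q hq hne h
  exact hne (logCoord_injOn hq hp h)

/-- The polar difference quotient is the slope of `f ∘ expCoord` divided by the slope of `exp`,
whose limit is nonzero. -/
theorem hasPolarDerivAt_iff {f : ℝ × ℝ → ℂ} {d : ℂ} {p : ℝ × ℝ} (hp : p ∈ halfPlane) :
    HasPolarDerivAt f d p ↔
      HasDerivAt (f ∘ expCoord) (d * Complex.exp (logCoord p)) (logCoord p) := by
  set w := logCoord p with hw
  have hpw : expCoord w = p := expCoord_logCoord hp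
  have hexp := hasDerivAt_iff_tendsto_slope.mp (Complex.hasDerivAt_exp w)
  have hne : ∀ᶠ v in 𝓝[≠] w, Complex.exp v - Complex.exp w ≠ 0 := by
    have := (tendsto_expCoord_punctured w).eventually
      (toComplex_sub_ne _ (expCoord_mem_halfPlane w))
    simpa only [toComplex_expCoord] using this
  rw [hasDerivAt_iff_tendsto_slope]
  constructor
  · intro h
    have h1 : Tendsto (fun v => (f (expCoord v) - f p) / (toComplex (expCoord v) - toComplex p))
        (𝓝[≠] w) (𝓝 d) := by
      have := tendsto_expCoord_punctured w
      rw [hpw] at this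
      exact h.comp this
    refine (h1.mul hexp).congr' ?_
    filter_upwards [hne] with v hv
    rw [slope_def_field, slope_def_field, toComplex_expCoord, ← exp_logCoord hp, ← hw,
      Function.comp_apply, Function.comp_apply, hpw]
    field_simp
  · intro h
    have h1 := h.div hexp (Complex.exp_ne_zero w)
    rw [mul_div_cancel_right₀ _ (Complex.exp_ne_zero w)] at h1
    refine (h1.comp (tendsto_logCoord_punctured hp)).congr' ?_
    filter_upwards [nhdsWithin_le_nhds (isOpen_halfPlane.mem_nhds hp), self_mem_nhdsWithin]
      with q hq hqp
    have hqw : logCoord q - w ≠ 0 := sub_ne_zero.mpr fun h => hqp (logCoord_injOn hq hp h)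
    simp only [Function.comp_apply, Pi.div_apply, slope_def_field, hpw, expCoord_logCoord hq]
    rw [exp_logCoord hq, exp_logCoord hp, div_div_div_cancel_right₀ hqw]

theorem HasPolarDerivAt.polarDeriv_eq {f : ℝ × ℝ → ℂ} {d : ℂ} {p : ℝ × ℝ}
    (h : HasPolarDerivAt f d p) : polarDeriv f p = d := h.limUnder_eq

theorem PolarAnalyticOn.differentiableAt {f : ℝ × ℝ → ℂ} {U : Set (ℝ × ℝ)}
    (hf : PolarAnalyticOn f U) {w : ℂ} (hw : expCoord w ∈ U) :
    DifferentiableAt ℂ (f ∘ expCoord) w := by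
  obtain ⟨d, hd⟩ := hf _ hw
  have := (hasPolarDerivAt_iff (expCoord_mem_halfPlane w)).mp hd
  rw [logCoord_expCoord] at this
  exact this.differentiableAt

theorem polarAnalyticOn_of_differentiableAt {f : ℝ × ℝ → ℂ} {U : Set (ℝ × ℝ)}
    (hU : U ⊆ halfPlane) (hf : ∀ w, expCoord w ∈ U → DifferentiableAt ℂ (f ∘ expCoord) w) :
    PolarAnalyticOn f U := fun p hp => by
  have hd := (hf (logCoord p) (by rwa [expCoord_logCoord (hU hp)])).hasDerivAt
  refine ⟨deriv (f ∘ expCoord) (logCoord p) * Complex.exp (-logCoord p),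
    (hasPolarDerivAt_iff (hU hp)).mpr ?_⟩
  rwa [mul_assoc, ← Complex.exp_add, neg_add_cancel, Complex.exp_zero, mul_one]

theorem PolarAnalyticOn.hasDerivAt {f : ℝ × ℝ → ℂ} {U : Set (ℝ × ℝ)}
    (hf : PolarAnalyticOn f U) {w : ℂ} (hw : expCoord w ∈ U) :
    HasDerivAt (f ∘ expCoord) (polarDeriv f (expCoord w) * Complex.exp w) w := by
  obtain ⟨d, hd⟩ := hf _ hw
  have := (hasPolarDerivAt_iff (expCoord_mem_halfPlane w)).mp hd
  rwa [logCoord_expCoord, ← hd.polarDeriv_eq] at this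

/-- In the coordinate `w` the polar derivative is `e^{-w} d/dw`, and the derivative of a holomorphic
function is holomorphic. -/
theorem PolarAnalyticOn.polarDeriv {f : ℝ × ℝ → ℂ} {U : Set (ℝ × ℝ)} (hU : IsOpen U)
    (hUH : U ⊆ halfPlane) (hf : PolarAnalyticOn f U) : PolarAnalyticOn (polarDeriv f) U := by
  have hV : IsOpen (expCoord ⁻¹' U) := hU.preimage continuous_expCoord
  have hF : DifferentiableOn ℂ (f ∘ expCoord) (expCoord ⁻¹' U) := fun w hw =>
    (hf.differentiableAt hw).differentiableWithinAt
  refine polarAnalyticOn_of_differentiableAt hUH fun w hw => ?_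
  have h1 : DifferentiableAt ℂ (fun v => deriv (f ∘ expCoord) v * Complex.exp (-v)) w :=
    ((hF.deriv hV).differentiableAt (hV.mem_nhds hw)).mul (by fun_prop)
  refine h1.congr_of_eventuallyEq ?_
  filter_upwards [hV.mem_nhds hw] with v hv
  rw [(hf.hasDerivAt hv).deriv, mul_assoc, ← Complex.exp_add, add_neg_cancel, Complex.exp_zero,
    mul_one, Function.comp_apply]

theorem PolarAnalyticOn.iterate_polarDeriv {f : ℝ × ℝ → ℂ} {U : Set (ℝ × ℝ)} (hU : IsOpen U)
    (hUH : U ⊆ halfPlane) (hf : PolarAnalyticOn f U) (j : ℕ) :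
    PolarAnalyticOn (Polar.polarDeriv^[j] f) U := by
  induction j with
  | zero => exact hf
  | succ j ih =>
    rw [Function.iterate_succ_apply']
    exact ih.polarDeriv hU hUH

/-! ### Mellin derivatives as derivatives of `e^{cw} g`. -/

theorem stirling_eq_zero_of_lt (c : ℝ) : ∀ {k j : ℕ}, k < j → stirling c k j = 0
  | 0, _ + 1, _ => rfl
  | k + 1, j + 1, h => by
    rw [stirling, stirling_eq_zero_of_lt c (Nat.lt_of_succ_lt_succ h),
      stirling_eq_zero_of_lt c (Nat.lt_of_succ_lt h)]
    simp

/-- `T j` stands for `e^{jw} D_pol^j g`, whose `w`-derivative is `j T j + T (j + 1)`; the factor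
`e^{cw}` contributes `c`. The index shift uses that `S_c(k, k + 1)` vanishes. -/
theorem sum_stirling_succ (c : ℝ) (k : ℕ) (T : ℕ → ℂ) :
    c * ∑ j ∈ Finset.range (k + 1), (stirling c k j : ℂ) * T j +
      ∑ j ∈ Finset.range (k + 1), (stirling c k j : ℂ) * (j * T j + T (j + 1)) =
    ∑ j ∈ Finset.range (k + 2), (stirling c (k + 1) j : ℂ) * T j := by
  have h1 : ∑ j ∈ Finset.range (k + 1), (stirling c k j : ℂ) * ((c + j) * T j) =
      ∑ j ∈ Finset.range (k + 1), (stirling c k (j + 1) : ℂ) * ((c + (j + 1)) * T (j + 1)) +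
        stirling c k 0 * (c * T 0) := by
    have a := Finset.sum_range_succ (fun j => (stirling c k j : ℂ) * ((c + j) * T j)) (k + 1)
    have b := Finset.sum_range_succ' (fun j => (stirling c k j : ℂ) * ((c + j) * T j)) (k + 1)
    rw [stirling_eq_zero_of_lt c (Nat.lt_succ_self k)] at a
    rw [a] at b
    simpa using b
  rw [Finset.sum_range_succ' _ (k + 1)]
  have h2 : ∑ j ∈ Finset.range (k + 1), (stirling c (k + 1) (j + 1) : ℂ) * T (j + 1) =
      ∑ j ∈ Finset.range (k + 1), (stirling c k j : ℂ) * T (j + 1) +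
      ∑ j ∈ Finset.range (k + 1), (stirling c k (j + 1) : ℂ) * ((c + (j + 1)) * T (j + 1)) := by
    rw [← Finset.sum_add_distrib]
    refine Finset.sum_congr rfl fun j _ => ?_
    rw [stirling]
    push_cast
    ring
  have h3 : (stirling c (k + 1) 0 : ℂ) * T 0 = stirling c k 0 * (c * T 0) := by
    rw [stirling]
    push_cast
    ring
  rw [h2, h3, add_assoc, ← h1, Finset.mul_sum, ← Finset.sum_add_distrib, ← Finset.sum_add_distrib]
  refine Finset.sum_congr rfl fun j _ => ?_
  ring

theorem PolarAnalyticOn.hasDerivAt_exp_mul_mellinDeriv {g : ℝ × ℝ → ℂ} {U : Set (ℝ × ℝ)}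
    (hU : IsOpen U) (hUH : U ⊆ halfPlane) (hg : PolarAnalyticOn g U) (c : ℝ) (k : ℕ) {w : ℂ}
    (hw : expCoord w ∈ U) :
    HasDerivAt (fun v => Complex.exp (c * v) * mellinDeriv c k g (expCoord v))
      (Complex.exp (c * w) * mellinDeriv c (k + 1) g (expCoord w)) w := by
  have hT : ∀ j : ℕ, HasDerivAt
      (fun v => Complex.exp v ^ j * (Polar.polarDeriv^[j] g) (expCoord v))
      (j * (Complex.exp w ^ j * (Polar.polarDeriv^[j] g) (expCoord w)) +
        Complex.exp w ^ (j + 1) * (Polar.polarDeriv^[j + 1] g) (expCoord w)) w := fun j => by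
    have h1 := (Complex.hasDerivAt_exp w).pow j
    have h2 := (hg.iterate_polarDeriv hU hUH j).hasDerivAt hw
    refine (h1.mul h2).congr_deriv ?_
    rw [Function.iterate_succ_apply', Function.comp_apply, Pi.pow_apply]
    rcases j with _ | j
    · simp [mul_comm]
    · simp only [Nat.add_sub_cancel]
      ring
  have hS : HasDerivAt (fun v => mellinDeriv c k g (expCoord v))
      (∑ j ∈ Finset.range (k + 1), (stirling c k j : ℂ) *
        (j * (Complex.exp w ^ j * (Polar.polarDeriv^[j] g) (expCoord w)) +
        Complex.exp w ^ (j + 1) * (Polar.polarDeriv^[j + 1] g) (expCoord w))) w := by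
    have := HasDerivAt.fun_sum (u := Finset.range (k + 1))
      fun j _ => (hT j).const_mul (stirling c k j : ℂ)
    refine this.congr_of_eventuallyEq (Eventually.of_forall fun v => ?_)
    simp only [mellinDeriv, toComplex_expCoord, mul_assoc]
  have hE : HasDerivAt (fun v : ℂ => Complex.exp (c * v)) (Complex.exp (c * w) * c) w := by
    simpa using ((hasDerivAt_id w).const_mul (c : ℂ)).cexp
  refine (hE.mul hS).congr_deriv ?_
  have := sum_stirling_succ c k
    fun j => Complex.exp w ^ j * (Polar.polarDeriv^[j] g) (expCoord w)
  simp only [mellinDeriv, toComplex_expCoord, mul_assoc] at this ⊢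
  rw [← this]
  ring

theorem PolarAnalyticOn.iteratedDeriv_exp_mul {g : ℝ × ℝ → ℂ} {U : Set (ℝ × ℝ)}
    (hU : IsOpen U) (hUH : U ⊆ halfPlane) (hg : PolarAnalyticOn g U) (c : ℝ) (k : ℕ) {w : ℂ}
    (hw : expCoord w ∈ U) :
    iteratedDeriv k (fun v => Complex.exp (c * v) * g (expCoord v)) w =
      Complex.exp (c * w) * mellinDeriv c k g (expCoord w) := by
  have hV : IsOpen (expCoord ⁻¹' U) := hU.preimage continuous_expCoord
  induction k generalizing w with
  | zero => simp [mellinDeriv, stirling]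
  | succ k ih =>
    rw [iteratedDeriv_succ]
    refine HasDerivAt.deriv ?_
    refine (hg.hasDerivAt_exp_mul_mellinDeriv hU hUH c k hw).congr_of_eventuallyEq ?_
    filter_upwards [hV.mem_nhds hw] with v hv using ih hv

/-! ### Logarithmic poles as ordinary poles. -/

theorem log_div_add_eq {p q : ℝ × ℝ} (hp : p ∈ halfPlane) (hq : q ∈ halfPlane) :
    ((Real.log (q.1 / p.1) : ℂ) + Complex.I * ((q.2 - p.2 : ℝ) : ℂ)) =
      logCoord q - logCoord p := by
  rw [Real.log_div (ne_of_gt hq) (ne_of_gt hp), logCoord, logCoord]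
  push_cast
  ring

/-- In the logarithmic coordinate a logarithmic pole is an ordinary pole of `e^{cw} f`, and the
`c`-residue is the ordinary residue. -/
theorem IsLogPole.exists_analyticAt {f : ℝ × ℝ → ℂ} {p : ℝ × ℝ} (h : IsLogPole f p) (c : ℝ) :
    ∃ (k : ℕ) (A : ℂ → ℂ), AnalyticAt ℂ A (logCoord p) ∧ A (logCoord p) ≠ 0 ∧
      (∀ᶠ w in 𝓝[≠] (logCoord p),
        Complex.exp (c * w) * f (expCoord w) = A w / (w - logCoord p) ^ (k + 1)) ∧
      residue c f p = iteratedDeriv k A (logCoord p) / (k.factorial : ℂ) := by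
  obtain ⟨k, g, h⟩ := h
  have hres := residue_eq c h
  obtain ⟨hk, hg0, U, hU, hUH, hpU, -, hg, hfg⟩ := h
  have hp := hUH hpU
  have hV : IsOpen (expCoord ⁻¹' U) := hU.preimage continuous_expCoord
  have hpV : logCoord p ∈ expCoord ⁻¹' U := by rwa [mem_preimage, expCoord_logCoord hp]
  obtain ⟨k, rfl⟩ := Nat.exists_eq_add_of_le' hk
  refine ⟨k, fun v => Complex.exp (c * v) * g (expCoord v), ?_, ?_, ?_, ?_⟩
  · have hd : DifferentiableOn ℂ (fun v => Complex.exp (c * v) * g (expCoord v))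
        (expCoord ⁻¹' U) := fun w hw =>
      (((by fun_prop : DifferentiableAt ℂ (fun v : ℂ => Complex.exp (c * v)) w)).mul
        (hg.differentiableAt hw)).differentiableWithinAt
    exact hd.analyticAt (hV.mem_nhds hpV)
  · simpa [expCoord_logCoord hp, Complex.exp_ne_zero] using hg0
  · filter_upwards [nhdsWithin_le_nhds (hV.mem_nhds hpV), self_mem_nhdsWithin] with w hw hne
    have hne' : expCoord w ≠ p := fun e => hne (by rw [← e, logCoord_expCoord]; rfl)
    rw [hfg _ ⟨hw, hne'⟩, log_div_add_eq hp (expCoord_mem_halfPlane w), logCoord_expCoord,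
      mul_div_assoc]
  · rw [hg.iteratedDeriv_exp_mul hU hUH c k hpV, hres, cpow_eq_exp hp, expCoord_logCoord hp,
      Nat.add_sub_cancel]

/-! ### Principal parts. -/

section PrincipalPart

/-- Each `dslope` at `p` shifts the power series by one, so the value at `p` after `k` steps is the
`k`-th Taylor coefficient. -/
theorem iterate_dslope_apply_self {A : ℂ → ℂ} {p : ℂ} (hA : AnalyticAt ℂ A p) (k : ℕ) :
    (Function.swap dslope p)^[k] A p = iteratedDeriv k A p / (k.factorial : ℂ) := by
  have h := hA.hasFPowerSeriesAt.has_fpower_series_iterate_dslope_fslope k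
  rw [← h.coeff_zero 1, ← FormalMultilinearSeries.coeff,
    FormalMultilinearSeries.coeff_iterate_fslope, zero_add,
    FormalMultilinearSeries.coeff_ofScalars]

/-- Each division by `w - p` splits off the value at `p` as a new polar term. The coefficient of `(w
- p)⁻¹`, the term `n = 0`, is the `k`-th Taylor coefficient, that is, the residue. -/
theorem div_pow_eq_sum_add (A : ℂ → ℂ) (p : ℂ) (k : ℕ) {w : ℂ} (hw : w ≠ p) :
    A w / (w - p) ^ (k + 1) =
      ∑ n ∈ Finset.range (k + 1),
        (Function.swap dslope p)^[k - n] A p * ((w - p) ^ (n + 1))⁻¹ +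
      (Function.swap dslope p)^[k + 1] A w := by
  have hwp : w - p ≠ 0 := sub_ne_zero.mpr hw
  have hstep : ∀ j, (Function.swap dslope p)^[j] A w / (w - p) =
      (Function.swap dslope p)^[j] A p * (w - p)⁻¹ + (Function.swap dslope p)^[j + 1] A w := by
    intro j
    rw [Function.iterate_succ_apply']
    change _ = _ + dslope _ p w
    rw [dslope_of_ne _ hw, slope_def_field]
    field_simp
    ring
  induction k with
  | zero => simpa using hstep 0
  | succ k ih =>
    rw [pow_succ (w - p) (k + 1), ← div_div, ih, add_div, hstep (k + 1),
      Finset.sum_range_succ' _ (k + 1), Finset.sum_div]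
    simp only [Nat.add_sub_add_right, Nat.sub_zero, zero_add, pow_one, ← add_assoc]
    congr 2
    refine Finset.sum_congr rfl fun n _ => ?_
    rw [pow_succ (w - p) (n + 1), mul_inv, mul_div_assoc, div_eq_mul_inv]

theorem analyticAt_iterate_dslope {A : ℂ → ℂ} {p : ℂ} (hA : AnalyticAt ℂ A p) (k : ℕ) :
    AnalyticAt ℂ ((Function.swap dslope p)^[k] A) p :=
  (hA.hasFPowerSeriesAt.has_fpower_series_iterate_dslope_fslope k).analyticAt

theorem IsLogPole.exists_principalPart {f : ℝ × ℝ → ℂ} {p : ℝ × ℝ} (h : IsLogPole f p) (c : ℝ) :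
    ∃ (k : ℕ) (b : ℕ → ℂ) (B : ℂ → ℂ), DifferentiableAt ℂ B (logCoord p) ∧
      (∀ᶠ w in 𝓝[≠] (logCoord p), Complex.exp (c * w) * f (expCoord w) =
        ∑ n ∈ Finset.range (k + 1), b n * ((w - logCoord p) ^ (n + 1))⁻¹ + B w) ∧
      residue c f p = b 0 := by
  obtain ⟨k, A, hA, -, hf, hres⟩ := h.exists_analyticAt c
  refine ⟨k, fun n => (Function.swap dslope (logCoord p))^[k - n] A (logCoord p), _,
    (analyticAt_iterate_dslope hA (k + 1)).differentiableAt, ?_, ?_⟩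
  · filter_upwards [hf, self_mem_nhdsWithin] with w hw hne
    rw [hw, div_pow_eq_sum_add A _ k hne]
  · simp only [hres, Nat.sub_zero, iterate_dslope_apply_self hA]

/-- Subtracting the principal parts at finitely many poles leaves a holomorphic function. -/
theorem exists_sub_principalPart_differentiableAt {F : ℂ → ℂ} {Ω : Set ℂ} {P : Finset ℂ}
    {k : ℂ → ℕ} {b : ℂ → ℕ → ℂ} {B : ℂ → ℂ → ℂ}
    (hF : ∀ w ∈ Ω, w ∉ P → DifferentiableAt ℂ F w)
    (hB : ∀ p ∈ P, DifferentiableAt ℂ (B p) p)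
    (hP : ∀ p ∈ P, ∀ᶠ w in 𝓝[≠] p,
      F w = ∑ n ∈ Finset.range (k p + 1), b p n * ((w - p) ^ (n + 1))⁻¹ + B p w) :
    ∃ H : ℂ → ℂ, (∀ w ∈ Ω, DifferentiableAt ℂ H w) ∧ ∀ w ∉ P,
      F w = H w + ∑ p ∈ P, ∑ n ∈ Finset.range (k p + 1), b p n * ((w - p) ^ (n + 1))⁻¹ := by
  classical
  set pp : ℂ → ℂ → ℂ := fun p w =>
    ∑ n ∈ Finset.range (k p + 1), b p n * ((w - p) ^ (n + 1))⁻¹ with hpp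
  have hppd : ∀ p w, w ≠ p → DifferentiableAt ℂ (pp p) w := fun p w hne => by
    have h0 : ∀ n, (w - p) ^ (n + 1) ≠ 0 := fun n => pow_ne_zero _ (sub_ne_zero.mpr hne)
    refine DifferentiableAt.fun_sum fun n _ => DifferentiableAt.const_mul ?_ _
    exact DifferentiableAt.fun_inv (h := fun v => (v - p) ^ (n + 1)) (by fun_prop) (h0 n)
  -- The value of `F` at a pole is arbitrary, so there the regular part `B w` is used, less the
  -- principal parts of the other poles.
  refine ⟨fun w => if w ∈ P then B w w - ∑ q ∈ P.erase w, pp q w else F w - ∑ p ∈ P, pp p w,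
    fun w hw => ?_, fun w hw => by simp [hw, hpp]⟩
  by_cases hwP : w ∈ P
  · have hd : DifferentiableAt ℂ (fun v => B w v - ∑ q ∈ P.erase w, pp q v) w :=
      (hB w hwP).sub (DifferentiableAt.fun_sum fun q hq =>
        hppd q w (Finset.ne_of_mem_erase hq).symm)
    refine hd.congr_of_eventuallyEq ?_
    have hn : ∀ᶠ v in 𝓝 w, v ∉ ((P.erase w : Finset ℂ) : Set ℂ) :=
      (P.erase w).finite_toSet.isClosed.isOpen_compl.mem_nhds (by simp)
    filter_upwards [eventually_nhdsWithin_iff.mp (hP w hwP), hn] with v hv hvn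
    by_cases hvw : v = w
    · rw [hvw, if_pos hwP]
    · have hvP : v ∉ P := fun h => hvn (by simp [hvw, h])
      rw [if_neg hvP, hv hvw, ← Finset.add_sum_erase P (fun p => pp p v) hwP]
      simp only [hpp]
      ring
  · have hd : DifferentiableAt ℂ (fun v => F v - ∑ p ∈ P, pp p v) w :=
      (hF w hw hwP).sub (DifferentiableAt.fun_sum fun q hq =>
        hppd q w fun h => hwP (h ▸ hq))
    refine hd.congr_of_eventuallyEq ?_
    have hn : ∀ᶠ v in 𝓝 w, v ∉ (P : Set ℂ) :=
      P.finite_toSet.isClosed.isOpen_compl.mem_nhds hwP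
    filter_upwards [hn] with v hv
    exact if_neg hv

end PrincipalPart

/-! ### One-forms `Φ(w) dw` and their integrals along the boundary curve. -/

section LogForm

/-- The form `Φ(w) dw` in the logarithmic coordinate `w = log r + iθ`. -/
noncomputable def logForm (Φ : ℂ → ℂ) (p : ℝ × ℝ) : ℝ × ℝ →L[ℝ] ℂ :=
  Φ (logCoord p) • logCoordDeriv p

theorem form_eq_logForm (c : ℝ) (f : ℝ × ℝ → ℂ) {p : ℝ × ℝ} (hp : p ∈ halfPlane) :
    form c f p = logForm (fun w => Complex.exp (c * w) * f (expCoord w)) p := by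
  have hp0 : (p.1 : ℂ) ≠ 0 := by exact_mod_cast (ne_of_gt hp : p.1 ≠ 0)
  have h1 : cpow (c - 1) p * ((p.1 : ℂ) * Complex.exp (Complex.I * p.2)) = cpow c p := by
    rw [← toComplex, ← exp_logCoord hp, cpow_eq_exp hp, cpow_eq_exp hp, ← Complex.exp_add]
    congr 1
    push_cast
    ring
  rw [form, logForm, logCoordDeriv, ← cpow_eq_exp hp, expCoord_logCoord hp, ← h1]
  ext
  · simp
    field_simp
  · simp
    ring

theorem hasFDerivAt_comp_logCoord {Φ Ψ : ℂ → ℂ} {p : ℝ × ℝ} (hp : p ∈ halfPlane)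
    (h : HasDerivAt Ψ (Φ (logCoord p)) (logCoord p)) :
    HasFDerivAt (Ψ ∘ logCoord) (logForm Φ p) p :=
  h.comp_hasFDerivAt p (hasFDerivAt_logCoord hp)

theorem hasFDerivAt_logCoordDeriv {p : ℝ × ℝ} (hp : p ∈ halfPlane) :
    HasFDerivAt logCoordDeriv ((Complex.ofRealCLM.comp ((-(p.1 ^ 2)⁻¹) •
      ContinuousLinearMap.fst ℝ ℝ ℝ)).smulRight
        (Complex.ofRealCLM.comp (ContinuousLinearMap.fst ℝ ℝ ℝ))) p := by
  have h1 : HasFDerivAt (fun q : ℝ × ℝ => q.1⁻¹)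
      ((-(p.1 ^ 2)⁻¹) • ContinuousLinearMap.fst ℝ ℝ ℝ) p :=
    (hasDerivAt_inv (ne_of_gt hp)).comp_hasFDerivAt p hasFDerivAt_fst
  have h2 : HasFDerivAt (fun q : ℝ × ℝ => ((q.1⁻¹ : ℝ) : ℂ))
      (Complex.ofRealCLM.comp ((-(p.1 ^ 2)⁻¹) • ContinuousLinearMap.fst ℝ ℝ ℝ)) p :=
    Complex.ofRealCLM.hasFDerivAt.comp p h1
  exact (h2.smul_const _).add_const _

theorem continuousOn_logForm {Φ : ℂ → ℂ} {s : Set (ℝ × ℝ)} (hs : s ⊆ halfPlane)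
    (hΦ : ∀ p ∈ s, ContinuousAt Φ (logCoord p)) : ContinuousOn (logForm Φ) s := fun p hp =>
  (((hΦ p hp).comp (continuousAt_logCoord (hs hp))).smul
    (hasFDerivAt_logCoordDeriv (hs hp)).continuousAt).continuousWithinAt

/-- Poincaré lemma on a set convex in `(r, θ)`. The derivative of the form combines `dr ⊗ dr` and
`dw ⊗ dw`, both symmetric, so the form is closed. -/
theorem exists_hasFDerivAt_logForm {H : ℂ → ℂ} {s : Set (ℝ × ℝ)} (hs : IsOpen s)
    (hc : Convex ℝ s) (hsH : s ⊆ halfPlane) (hH : ∀ p ∈ s, DifferentiableAt ℂ H (logCoord p)) :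
    ∃ Q : ℝ × ℝ → ℂ, ∀ p ∈ s, HasFDerivAt Q (logForm H p) p := by
  have hd : ∀ p ∈ s, HasFDerivAt (logForm H) (H (logCoord p) •
      ((Complex.ofRealCLM.comp ((-(p.1 ^ 2)⁻¹) • ContinuousLinearMap.fst ℝ ℝ ℝ)).smulRight
        (Complex.ofRealCLM.comp (ContinuousLinearMap.fst ℝ ℝ ℝ))) +
      (deriv H (logCoord p) • logCoordDeriv p).smulRight (logCoordDeriv p)) p := fun p hp =>
    ((hH p hp).hasDerivAt.comp_hasFDerivAt p (hasFDerivAt_logCoord (hsH hp))).smul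
      (hasFDerivAt_logCoordDeriv (hsH hp))
  refine hc.exists_forall_hasFDerivAt_of_fderiv_symmetric hs
    (fun p hp => (hd p hp).differentiableAt.differentiableWithinAt) fun p hp x y => ?_
  rw [(hd p hp).fderiv]
  simp [logCoordDeriv]
  ring

/-- Because `log` is increasing, the real part is positive: it is a positive multiple of `(log x.1 -
log p.1)(x.1 - p.1) + (x.2 - p.2)²`. Hence the principal logarithm of this quotient is
differentiable on the half-plane without `p`. -/
theorem div_toPlane_mem_slitPlane {p x : ℝ × ℝ} (hp : p ∈ halfPlane) (hx : x ∈ halfPlane)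
    (hne : x ≠ p) :
    (logCoord x - logCoord p) * (toPlane (x - p))⁻¹ ∈ Complex.slitPlane := by
  left
  have hT : 0 < Complex.normSq (toPlane (x - p)) :=
    Complex.normSq_pos.mpr (toPlane_ne_zero (sub_ne_zero.mpr hne))
  rw [Complex.mul_re, Complex.inv_re, Complex.inv_im]
  simp only [Complex.sub_re, Complex.sub_im, logCoord_re, logCoord_im, toPlane_re, toPlane_im,
    Prod.fst_sub, Prod.snd_sub]
  have e : (Real.log x.1 - Real.log p.1) * ((x.1 - p.1) / Complex.normSq (toPlane (x - p))) -
      (x.2 - p.2) * (-(x.2 - p.2) / Complex.normSq (toPlane (x - p))) =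
      ((Real.log x.1 - Real.log p.1) * (x.1 - p.1) + (x.2 - p.2) ^ 2) /
        Complex.normSq (toPlane (x - p)) := by ring
  rw [e]
  refine div_pos ?_ hT
  have hp' : 0 < p.1 := hp
  have hx' : 0 < x.1 := hx
  rcases lt_trichotomy x.1 p.1 with h | h | h
  · have := Real.log_lt_log hx' h
    nlinarith [sq_nonneg (x.2 - p.2), mul_pos (sub_pos.mpr this) (sub_pos.mpr h)]
  · have h2 : x.2 - p.2 ≠ 0 := sub_ne_zero.mpr fun h' => hne (Prod.ext h h')
    rw [h, sub_self, zero_mul, zero_add]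
    positivity
  · have := Real.log_lt_log hp' h
    nlinarith [sq_nonneg (x.2 - p.2), mul_pos (sub_pos.mpr this) (sub_pos.mpr h)]

/-- `dw / (w - w_p)` and `dζ / (ζ - ζ_p)` differ by an exact form. -/
theorem hasFDerivAt_log_div_toPlane {p x : ℝ × ℝ} (hp : p ∈ halfPlane) (hx : x ∈ halfPlane)
    (hne : x ≠ p) :
    HasFDerivAt (fun x => Complex.log ((logCoord x - logCoord p) * (toPlane (x - p))⁻¹))
      (logForm (fun w => (w - logCoord p)⁻¹) x - planeWindingForm p x) x := by
  have hT0 : toPlane (x - p) ≠ 0 := toPlane_ne_zero (sub_ne_zero.mpr hne)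
  have hN0 : logCoord x - logCoord p ≠ 0 :=
    sub_ne_zero.mpr fun h => hne (logCoord_injOn hx hp h)
  have hN : HasFDerivAt (fun x => logCoord x - logCoord p) (logCoordDeriv x) x :=
    (hasFDerivAt_logCoord hx).sub_const _
  have hT : HasFDerivAt (fun x => toPlane (x - p)) toPlane x :=
    toPlane.hasFDerivAt.comp x ((hasFDerivAt_id x).sub_const p)
  have hTi := (hasDerivAt_inv hT0).comp_hasFDerivAt x hT
  refine ((Complex.hasDerivAt_log (div_toPlane_mem_slitPlane hp hx hne)).comp_hasFDerivAt x
    (hN.mul hTi)).congr_fderiv ?_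
  refine ContinuousLinearMap.ext fun v => ?_
  simp only [logForm, planeWindingForm, _root_.smul_apply, _root_.add_apply, _root_.sub_apply,
    smul_eq_mul, Function.comp_apply]
  field_simp
  ring

variable {p₀ : ℝ × ℝ} {γ : Path p₀ p₀} {K : Set (ℝ × ℝ)}

theorem IsPosBoundary.integral_logForm_inv_pow (h : IsPosBoundary γ K)
    (hb : Bornology.IsBounded K) (hγH : range γ ⊆ halfPlane) (hKH : K ⊆ halfPlane)
    {p : ℝ × ℝ} (hp : p ∈ K) (n : ℕ) :
    ∫ t in (0 : ℝ)..1, logForm (fun w => ((w - logCoord p) ^ (n + 1))⁻¹) (γ.extend t)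
      (deriv γ.extend t) = if n = 0 then 2 * Real.pi * Complex.I else 0 := by
  have hpf : p ∉ range γ := fun hf => by
    rw [h.range_eq] at hf
    exact hf.2 (by rwa [h.isOpen.interior_eq])
  have hne : ∀ x ∈ range γ, x ≠ p := fun x hx e => hpf (e ▸ hx)
  have hw : ∀ x ∈ range γ, logCoord x - logCoord p ≠ 0 := fun x hx =>
    sub_ne_zero.mpr fun e => hne x hx (logCoord_injOn (hγH hx) (hKH hp) e)
  have hcont : ContinuousOn (logForm (fun w => ((w - logCoord p) ^ (n + 1))⁻¹)) (range γ) :=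
    continuousOn_logForm hγH fun x hx =>
      ContinuousAt.inv₀ (by fun_prop) (pow_ne_zero _ (hw x hx))
  rcases n with _ | n
  · simp only [zero_add, pow_one] at hcont ⊢
    have hcont2 := continuousOn_planeWindingForm hpf
    have h0 := h.piecewiseC1.integral_eq_zero_of_hasFDerivAt (hcont.sub hcont2) fun x hx =>
      hasFDerivAt_log_div_toPlane (hKH hp) (hγH hx) (hne x hx)
    have hs := intervalIntegral.integral_sub (h.piecewiseC1.intervalIntegrable_form hcont)
      (h.piecewiseC1.intervalIntegrable_form hcont2)
    rw [h.integral_planeWindingForm hb hp] at hs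
    rw [if_pos trivial]
    refine sub_eq_zero.mp (hs.symm.trans ?_)
    simpa using h0
  · rw [if_neg (Nat.succ_ne_zero n)]
    refine h.piecewiseC1.integral_eq_zero_of_hasFDerivAt hcont (Q := (fun w =>
      -((n + 1 : ℕ) : ℂ)⁻¹ * ((w - logCoord p) ^ (n + 1))⁻¹) ∘ logCoord) fun x hx => ?_
    refine hasFDerivAt_comp_logCoord (hγH hx) ?_
    have h0 := hw x hx
    have hn : ((n + 1 : ℕ) : ℂ) ≠ 0 := Nat.cast_ne_zero.mpr (Nat.succ_ne_zero n)
    have h1 := ((((hasDerivAt_id (logCoord x)).sub_const (logCoord p)).pow (n + 1)).inv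
      (pow_ne_zero _ h0)).const_mul (-((n + 1 : ℕ) : ℂ)⁻¹)
    refine h1.congr_deriv ?_
    simp only [id, Pi.pow_apply, Nat.add_sub_cancel]
    field_simp
    ring

end LogForm

theorem intervalIntegrable_finsetSum {ι : Type*} {s : Finset ι} {u : ι → ℝ → ℂ} {a b : ℝ}
    (h : ∀ i ∈ s, IntervalIntegrable (u i) volume a b) :
    IntervalIntegrable (fun t => ∑ i ∈ s, u i t) volume a b := by
  simpa only [Finset.sum_fn] using IntervalIntegrable.sum s h

/-! ### Isolation of the logarithmic poles. -/

theorem IsLogPole.tendsto_norm_atTop {f : ℝ × ℝ → ℂ} {p : ℝ × ℝ} (hp : p ∈ halfPlane)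
    (h : IsLogPole f p) : Tendsto (fun q => ‖f q‖) (𝓝[≠] p) atTop := by
  -- Taking `c = 0` makes the exponential factor equal to `1`.
  obtain ⟨k, A, hA, hA0, hf, -⟩ := h.exists_analyticAt 0
  have h1 : Tendsto (fun w => ‖A w‖) (𝓝[≠] (logCoord p)) (𝓝 ‖A (logCoord p)‖) :=
    hA.continuousAt.norm.tendsto.mono_left nhdsWithin_le_nhds
  have h2 : Tendsto (fun w => ‖w - logCoord p‖ ^ (k + 1)) (𝓝[≠] (logCoord p)) (𝓝[>] 0) := by
    refine tendsto_nhdsWithin_iff.mpr ⟨?_, ?_⟩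
    · have : ContinuousAt (fun w => ‖w - logCoord p‖ ^ (k + 1)) (logCoord p) := by fun_prop
      have := this.tendsto.mono_left (nhdsWithin_le_nhds (s := {logCoord p}ᶜ))
      simpa using this
    · filter_upwards [self_mem_nhdsWithin] with w hw
      exact pow_pos (norm_pos_iff.mpr (sub_ne_zero.mpr hw)) _
  have h3 := (h1.pos_mul_atTop (norm_pos_iff.mpr hA0) h2.inv_tendsto_nhdsGT_zero).comp
    (tendsto_logCoord_punctured hp)
  refine h3.congr' ?_
  filter_upwards [(tendsto_logCoord_punctured hp).eventually hf,
    nhdsWithin_le_nhds (isOpen_halfPlane.mem_nhds hp)] with q hq hqH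
  rw [expCoord_logCoord hqH] at hq
  have hq' : f q = A (logCoord q) / (logCoord q - logCoord p) ^ (k + 1) := by simpa using hq
  rw [hq', norm_div, norm_pow, div_eq_mul_inv]
  rfl

theorem IsLogPole.not_continuousAt {f : ℝ × ℝ → ℂ} {p : ℝ × ℝ} (hp : p ∈ halfPlane)
    (h : IsLogPole f p) : ¬ ContinuousAt f p := fun hc =>
  not_tendsto_atTop_of_tendsto_nhds (hc.norm.tendsto.mono_left nhdsWithin_le_nhds)
    (h.tendsto_norm_atTop hp)

/-- The logarithmic poles of a function that is otherwise polar-analytic do not accumulate. -/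
theorem eventually_notMem_logPoles {D Z : Set (ℝ × ℝ)} {f : ℝ × ℝ → ℂ}
    (hDsub : D ⊆ halfPlane) (hZD : Z ⊆ D) (hf : PolarAnalyticOn f (D \ Z))
    (hZ : ∀ p ∈ Z, IsLogPole f p) {x : ℝ × ℝ} (hx : x ∈ D) : ∀ᶠ q in 𝓝[≠] x, q ∉ Z := by
  by_cases hxZ : x ∈ Z
  · obtain ⟨k, g, -, -, U, hU, hUH, hxU, hfU, -⟩ := hZ x hxZ
    filter_upwards [nhdsWithin_le_nhds (hU.mem_nhds hxU), self_mem_nhdsWithin] with q hq hne hqZ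
    obtain ⟨d, hd⟩ := hfU q ⟨hq, hne⟩
    exact (hZ q hqZ).not_continuousAt (hUH hq) (hd.continuousAt (hUH hq))
  -- Near a regular point `f` is bounded, while near any pole it is unbounded.
  · obtain ⟨d, hd⟩ := hf x ⟨hx, hxZ⟩
    have hc := (hd.continuousAt (hDsub hx)).norm
    have hev : ∀ᶠ q in 𝓝 x, ‖f q‖ < ‖f x‖ + 1 := hc.eventually_lt_const (by linarith)
    refine nhdsWithin_le_nhds ?_
    filter_upwards [eventually_eventually_nhds.mpr hev] with q hq hqZ
    have h1 := (hZ q hqZ).tendsto_norm_atTop (hDsub (hZD hqZ))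
    have h2 := (h1.eventually_ge_atTop (‖f x‖ + 1)).and
      (hq.filter_mono (nhdsWithin_le_nhds (s := {q}ᶜ)))
    obtain ⟨y, hy1, hy2⟩ := h2.exists
    exact absurd hy1 (not_le.mpr hy2)

end Polar

/-! ### The residue theorem. -/

theorem theorem4p2 (D : Set (ℝ × ℝ)) (hDopen : IsOpen D) (hDconv : Convex ℝ D)
    (hDsub : D ⊆ Polar.halfPlane)
    (f : ℝ × ℝ → ℂ) (Z : Set (ℝ × ℝ)) (hZD : Z ⊆ D)
    (hf : Polar.PolarAnalyticOn f (D \ Z)) (hZ : ∀ p ∈ Z, Polar.IsLogPole f p)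
    (p₀ : ℝ × ℝ) (γ : Path p₀ p₀) (K : Set (ℝ × ℝ)) (hγ : Polar.IsPosBoundary γ K)
    (hKD : K ⊆ D) (hγD : Set.range γ ⊆ D) (hγZ : Disjoint (Set.range γ) Z) (c : ℝ) :
    (Z ∩ K).Finite ∧ CurveIntegrable (Polar.form c f) γ ∧
      curveIntegral (Polar.form c f) γ =
        2 * Real.pi * Complex.I * ∑ᶠ p ∈ Z ∩ K, Polar.residue c f p := by
  classical
  have hev : ∀ x ∈ D, ∀ᶠ q in 𝓝[≠] x, q ∉ Z := fun x hx =>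
    Polar.eventually_notMem_logPoles hDsub hZD hf hZ hx
  have hb : Bornology.IsBounded K :=
    Polar.isBounded_of_isCompact_frontier hγ.isOpen (hKD.trans hDsub)
      (hγ.range_eq ▸ isCompact_range γ.continuous)
  have hcK : IsCompact (closure K) := hb.isCompact_closure
  have hclD : closure K ⊆ D := by
    rw [closure_eq_self_union_frontier, ← hγ.range_eq]
    exact union_subset hKD hγD
  -- Infinitely many poles would accumulate in the compact set `closure K ⊆ D`.
  have hfin : (Z ∩ K).Finite := by
    by_contra hinf
    obtain ⟨x, hx, hacc⟩ := Set.Infinite.exists_accPt_of_subset_isCompact hinf hcK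
      (inter_subset_right.trans subset_closure)
    rw [accPt_iff_frequently] at hacc
    obtain ⟨y, ⟨hy1, hy2⟩, hy3⟩ :=
      (hacc.and_eventually (eventually_nhdsWithin_iff.mp (hev x (hclD hx)))).exists
    exact hy3 hy1 hy2.1
  -- a convex neighbourhood of `closure K` without poles outside `K`
  have hO : IsOpen {x | x ∈ D ∧ (x ∈ Z → x ∈ K)} := by
    rw [isOpen_iff_mem_nhds]
    rintro x ⟨hxD, hxZ⟩
    by_cases hxK : x ∈ K
    · filter_upwards [hγ.isOpen.mem_nhds hxK] with y hy using ⟨hKD hy, fun _ => hy⟩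
    · filter_upwards [hDopen.mem_nhds hxD, eventually_nhdsWithin_iff.mp (hev x hxD)] with y hyD hy
      refine ⟨hyD, fun hyZ => ?_⟩
      by_cases e : y = x
      · exact absurd (hxZ (e ▸ hyZ)) hxK
      · exact absurd hyZ (hy e)
  have hKO : closure K ⊆ {x | x ∈ D ∧ (x ∈ Z → x ∈ K)} := fun x hx => by
    refine ⟨hclD hx, fun hxZ => ?_⟩
    rw [closure_eq_self_union_frontier, ← hγ.range_eq] at hx
    exact hx.resolve_right fun h => hγZ.notMem_of_mem_left h hxZ
  obtain ⟨δ, hδ, hsub⟩ := hcK.exists_thickening_subset_open hO hKO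
  set D' := Metric.thickening δ (closure K)
  have hD'c : Convex ℝ D' := hγ.convex.closure.thickening δ
  have hD'o : IsOpen D' := Metric.isOpen_thickening
  have hD'H : D' ⊆ Polar.halfPlane := fun x hx => hDsub (hsub hx).1
  have hγD' : range γ ⊆ D' := by
    rw [hγ.range_eq]
    exact frontier_subset_closure.trans (Metric.self_subset_thickening hδ _)
  have hγH : range γ ⊆ Polar.halfPlane := hγD.trans hDsub
  set P : Finset ℂ := hfin.toFinset.image Polar.logCoord with hPdef
  have hPmem : ∀ w, w ∈ P ↔ Polar.expCoord w ∈ Z ∩ K := fun w => by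
    rw [hPdef, Finset.mem_image]
    constructor
    · rintro ⟨p, hp, rfl⟩
      rw [hfin.mem_toFinset] at hp
      rwa [Polar.expCoord_logCoord (hDsub (hZD hp.1))]
    · exact fun h => ⟨_, hfin.mem_toFinset.mpr h, Polar.logCoord_expCoord w⟩
  have hpole : ∀ w ∈ P, ∃ (k : ℕ) (b : ℕ → ℂ) (B : ℂ → ℂ), DifferentiableAt ℂ B w ∧
      (∀ᶠ v in 𝓝[≠] w, Complex.exp (c * v) * f (Polar.expCoord v) =
        ∑ n ∈ Finset.range (k + 1), b n * ((v - w) ^ (n + 1))⁻¹ + B v) ∧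
      Polar.residue c f (Polar.expCoord w) = b 0 := fun w hw => by
    have := (hZ _ ((hPmem w).mp hw).1).exists_principalPart c
    rwa [Polar.logCoord_expCoord] at this
  choose! k b B hB hFB hres using hpole
  set F : ℂ → ℂ := fun w => Complex.exp (c * w) * f (Polar.expCoord w) with hFdef
  obtain ⟨H, hH, hFH⟩ := Polar.exists_sub_principalPart_differentiableAt
    (F := F) (Ω := Polar.expCoord ⁻¹' D') (fun w hw hwP => by
      have hwZ : Polar.expCoord w ∈ D \ Z := ⟨(hsub hw).1, fun hz =>
        hwP ((hPmem w).mpr ⟨hz, (hsub hw).2 hz⟩)⟩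
      exact (by fun_prop : DifferentiableAt ℂ (fun v : ℂ => Complex.exp (c * v)) w).mul
        (hf.differentiableAt hwZ)) hB hFB
  have hH' : ∀ p ∈ D', DifferentiableAt ℂ H (Polar.logCoord p) := fun p hp =>
    hH _ (by rwa [mem_preimage, Polar.expCoord_logCoord (hD'H hp)])
  have hHcont : ContinuousOn (Polar.logForm H) (range γ) :=
    Polar.continuousOn_logForm hγH fun p hp => (hH' p (hγD' hp)).continuousAt
  obtain ⟨Q, hQ⟩ := Polar.exists_hasFDerivAt_logForm hD'o hD'c hD'H hH'
  have hH0 := hγ.piecewiseC1.integral_eq_zero_of_hasFDerivAt hHcont fun p hp => hQ p (hγD' hp)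
  have hHint := hγ.piecewiseC1.intervalIntegrable_form hHcont
  set J : ℂ → ℕ → ℝ → ℂ := fun w n t =>
    Polar.logForm (fun v => ((v - w) ^ (n + 1))⁻¹) (γ.extend t) (deriv γ.extend t) with hJdef
  have hγP : ∀ x ∈ range γ, Polar.logCoord x ∉ P := fun x hx hxP => by
    have := ((hPmem _).mp hxP).1
    rw [Polar.expCoord_logCoord (hγH hx)] at this
    exact hγZ.notMem_of_mem_left hx this
  have hJint : ∀ w ∈ P, ∀ n, IntervalIntegrable (J w n) volume 0 1 := fun w hw n => by
    refine hγ.piecewiseC1.intervalIntegrable_form (Polar.continuousOn_logForm hγH fun x hx => ?_)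
    have h0 : Polar.logCoord x - w ≠ 0 := sub_ne_zero.mpr fun e => hγP x hx (e ▸ hw)
    exact ContinuousAt.inv₀ (by fun_prop) (pow_ne_zero _ h0)
  have hJ : ∀ w ∈ P, ∀ n, ∫ t in (0 : ℝ)..1, J w n t =
      if n = 0 then 2 * Real.pi * Complex.I else 0 := fun w hw n => by
    have := hγ.integral_logForm_inv_pow hb hγH (hKD.trans hDsub) ((hPmem w).mp hw).2 n
    rwa [Polar.logCoord_expCoord] at this
  -- The trace avoids all poles, so the decomposition of `F` holds at every parameter, including the
  -- break points.
  have hform : (fun t => Polar.form c f (γ.extend t) (deriv γ.extend t)) = fun t =>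
      Polar.logForm H (γ.extend t) (deriv γ.extend t) +
        ∑ w ∈ P, ∑ n ∈ Finset.range (k w + 1), b w n * J w n t := by
    funext t
    have hx := Polar.extend_mem_range γ t
    have e := hFH _ (hγP _ hx)
    rw [Polar.form_eq_logForm c f (hγH hx)]
    simp only [Polar.logForm, hJdef, _root_.smul_apply, smul_eq_mul]
    change F _ * _ = _
    rw [e, add_mul, Finset.sum_mul]
    simp only [Finset.sum_mul, mul_assoc]
  have hsint : IntervalIntegrable
      (fun t => ∑ w ∈ P, ∑ n ∈ Finset.range (k w + 1), b w n * J w n t) volume 0 1 := by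
    refine Polar.intervalIntegrable_finsetSum fun w hw => Polar.intervalIntegrable_finsetSum fun n _ => ?_
    exact (hJint w hw n).const_mul _
  refine ⟨hfin, Polar.curveIntegrable_of_intervalIntegrable ?_, ?_⟩
  · rw [hform]
    exact hHint.add hsint
  · rw [curveIntegral_eq_intervalIntegral_deriv, hform,
      intervalIntegral.integral_add hHint hsint, hH0, zero_add,
      intervalIntegral.integral_finsetSum fun w hw =>
        Polar.intervalIntegrable_finsetSum fun n _ => (hJint w hw n).const_mul _,
      finsum_mem_eq_finite_toFinset_sum _ hfin, Finset.mul_sum, hPdef, Finset.sum_image]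
    · refine Finset.sum_congr rfl fun p hp => ?_
      have hpZ := hfin.mem_toFinset.mp hp
      have hpP : Polar.logCoord p ∈ P := Finset.mem_image_of_mem _ hp
      have hr := hres _ hpP
      rw [Polar.expCoord_logCoord (hDsub (hZD hpZ.1))] at hr
      rw [hr, intervalIntegral.integral_finsetSum fun n _ => (hJint _ hpP n).const_mul _]
      -- Only the term `n = 0` survives, and its coefficient `b 0` is the residue.
      simp only [intervalIntegral.integral_const_mul, hJ _ hpP]
      simp [mul_comm]
    · intro x hx y hy e
      have hx' := hfin.mem_toFinset.mp hx
      have hy' := hfin.mem_toFinset.mp hy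
      exact Polar.logCoord_injOn (hDsub (hZD hx'.1)) (hDsub (hZD hy'.1)) e
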